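/- Let $k$ be an algebraically closed field of characteristic zero and let $H$ be a Hopf algebra over $k$ with comultiplication $\Delta$. Let $H_0$ be the coradical of $H$ (the sum of all simple subcoalgebras) and let $H_{n+1}=\Delta^{-1}(H\otimes H_n+H_0\otimes H)$ for $n\ge 0$ be the coradical filtration. Assume that $H$ is connected, i.e. $H_0=k\cdot 1$, and locally finite, i.e. $\dim_k H_n<\infty$ for every $n$. Let $P(H)=\{x\in H:\Delta(x)=x\otimes 1+1\otimes x\}$ be the space of primitive elements. Then $$\dim_k P(H)\le \mathrm{gl.dim}(H),$$ where $\mathrm{gl.dim}(H)\in\mathbb{N}\cup\{\infty\}$ is the global dimension of $H$; the inequality holds both for the left global dimension and for the right global dimension of $H$. -/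

import Mathlib

open scoped TensorProduct

namespace ConnectedHopf

section Coalgebra

variable (k : Type*) {C : Type*} [Field k] [AddCommMonoid C] [Module k C] [Coalgebra k C]

/-- A subspace `D` of a `k`-coalgebra is a subcoalgebra if `Δ(D) ⊆ D ⊗ D`, where `D ⊗ D` is
viewed inside `C ⊗ C`. -/
def IsSubcoalgebra (D : Submodule k C) : Prop :=
  ∀ x ∈ D, Coalgebra.comul (R := k) x ∈ LinearMap.range (TensorProduct.mapIncl D D)

/-- A simple subcoalgebra: nonzero, with no subcoalgebras besides `0` and itself. -/
def IsSimpleSubcoalgebra (D : Submodule k C) : Prop :=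
  IsSubcoalgebra k D ∧ D ≠ ⊥ ∧
    ∀ E : Submodule k C, IsSubcoalgebra k E → E ≤ D → E = ⊥ ∨ E = D

variable (C)

/-- The coradical `C₀`: the sum of all simple subcoalgebras. -/
def coradical : Submodule k C :=
  sSup {D : Submodule k C | IsSimpleSubcoalgebra k D}

/-- The coradical filtration: `C₀` is the coradical and
`Cₙ₊₁ = Δ⁻¹(C ⊗ Cₙ + C₀ ⊗ C)`. -/
def coradicalFiltration : ℕ → Submodule k C
  | 0 => coradical k C
  | n + 1 =>
      (LinearMap.range (TensorProduct.mapIncl (⊤ : Submodule k C) (coradicalFiltration n)) ⊔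
        LinearMap.range (TensorProduct.mapIncl (coradical k C) (⊤ : Submodule k C))).comap
        (Coalgebra.comul (R := k))

end Coalgebra

section Hopf

variable (k H : Type*) [Field k] [Ring H] [HopfAlgebra k H]

/-- A Hopf algebra is connected if its coradical is `k · 1`. -/
def IsConnected : Prop :=
  coradicalFiltration k H 0 = Submodule.span k {(1 : H)}

/-- A connected Hopf algebra is locally finite if all terms of its coradical filtration are
finite-dimensional. -/
def IsLocallyFinite : Prop :=
  ∀ n : ℕ, Module.Finite k (coradicalFiltration k H n)

/-- The space `P(H)` of primitive elements: `Δ(x) = x ⊗ 1 + 1 ⊗ x`. -/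
def primitives : Submodule k H where
  carrier := {x | Coalgebra.comul (R := k) x = x ⊗ₜ[k] (1 : H) + (1 : H) ⊗ₜ[k] x}
  add_mem' {x y} hx hy := by
    simp only [Set.mem_ofPred_eq] at hx hy ⊢
    rw [map_add, hx, hy, TensorProduct.add_tmul, TensorProduct.tmul_add]
    abel
  zero_mem' := by simp
  smul_mem' c x hx := by
    simp only [Set.mem_ofPred_eq] at hx ⊢
    rw [map_smul, hx, smul_add, TensorProduct.smul_tmul', TensorProduct.tmul_smul]

end Hopf

section GlobalDimension

universe v

/-- The left global dimension of a ring: the supremum of the projective dimensions of all its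
left modules. (The zero ring gets `⊥`.) -/
noncomputable def leftGlobalDimension (R : Type v) [Ring R] : WithBot ℕ∞ :=
  ⨆ M : ModuleCat.{v} R, CategoryTheory.projectiveDimension M

/-- The right global dimension: right `R`-modules are left modules over the opposite ring. -/
noncomputable def rightGlobalDimension (R : Type v) [Ring R] : WithBot ℕ∞ :=
  leftGlobalDimension Rᵐᵒᵖ

end GlobalDimension

end ConnectedHopf

/-! Let g = P(H), of dimension d with basis x_i, and let ε be the counit. The proof follows the
argument that U(g) has global dimension at least d, with H in place of U(g). The Chevalley–Eilenberg
complex of free left modules H ⊗ Λ^p g, where g acts on H by right multiplication, is exact in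
positive degrees. If the cokernel of its lowest differential had projective dimension less than d,
dimension shifting would make the top differential a split injection. But that differential sends
the generator to ∑ x_i e_i with ε(x_i) = 0, so applying the retraction and then ε gives 1 = 0
(`card_le_leftGlobalDimension`).

Exactness (`koszulD_exact`) is proved without freeness of H over U(g). Filter H by G_0 = 0 and
G_{m+1} = {h : Δh ∈ h ⊗ 1 + G_m ⊗ H}. Functionals φ_i dual to the x_i with φ_i(1) = 0 give operators
δ_i h = ∑ φ_i(h₂) h₁ that lower the filtration and satisfy [δ_i, X_j] = δ_ij modulo lower terms, X_j
being the action of x_j. With the homotopy h = ∑ e_i ∧ δ_i one gets Dh + hD = E + p in degree p,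
modulo lower terms, where E = ∑ X_i δ_i. On G_m / G_{m-1} the product E(E - 1)⋯(E - m + 1) vanishes,
so E has only natural number eigenvalues and E + p is invertible for p > 0 in characteristic zero.
The associated graded complex is therefore exact, and induction on the filtration finishes.

Connectedness makes the filtration exhaustive (`exists_mem_coinvFiltration`). Otherwise the quotient
of H by the union of the G_m contains a finite-dimensional simple comodule; its matrix coefficients
span a simple subcoalgebra, necessarily k·1, so the comodule is trivial and its lifts already lie in
some G_m.

The right-hand inequality is the same argument for the opposite algebra, using left multiplications.
-/

namespace ConnectedHopf

/-! ### The identity D² = 0, from the canonical anticommutation relations. -/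

section CanonicalAnticommutation

variable {k E ι : Type*} [Field k] [Ring E] [Algebra k E]

/-- The Chevalley–Eilenberg differential, as an element of an algebra containing the action `X` of
a Lie algebra with structure constants `γ`, contractions `a` and wedge products `b`. -/
noncomputable def ceDifferential [Fintype ι] (γ : ι → ι → ι → k) (X a b : ι → E) : E :=
  ∑ i, X i * a i - (2⁻¹ : k) • ∑ l, (∑ i, ∑ j, γ i j l • (a i * a j)) * b l

variable {γ : ι → ι → ι → k} {X a b : ι → E}

theorem mul_contract_contract [DecidableEq ι]
    (hab : ∀ i j, a i * b j + b j * a i = if i = j then 1 else 0) (l i j : ι) :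
    b l * (a i * a j) = a i * a j * b l + ((if i = l then a j else 0) - if j = l then a i else 0) := by
  have h1 : b l * a i = (if i = l then 1 else 0) - a i * b l := by rw [← hab i l]; abel
  have h2 : b l * a j = (if j = l then 1 else 0) - a j * b l := by rw [← hab j l]; abel
  rw [← mul_assoc, h1, sub_mul, mul_assoc, h2, mul_sub, ite_mul, mul_ite]
  simp only [one_mul, zero_mul, mul_one, mul_zero, mul_assoc]
  abel

/-- Moving `b l` past either contraction leaves one linear term; antisymmetry of `γ` makes the two
equal, whence the factor 2. -/
theorem mul_bracketPart [Fintype ι] [DecidableEq ι] (hγ : ∀ i j l, γ j i l = -γ i j l)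
    (hab : ∀ i j, a i * b j + b j * a i = if i = j then 1 else 0) (l m : ι) :
    b l * (∑ i, ∑ j, γ i j m • (a i * a j)) =
      (∑ i, ∑ j, γ i j m • (a i * a j)) * b l + (2 : k) • ∑ j, γ l j m • a j := by
  simp only [Finset.mul_sum, Finset.sum_mul, mul_smul_comm, smul_mul_assoc,
    mul_contract_contract hab, smul_add, Finset.sum_add_distrib, smul_sub, Finset.sum_sub_distrib]
  congr 1
  simp only [smul_ite, smul_zero, Finset.sum_ite_eq', Finset.mem_univ, if_true]
  rw [Finset.sum_comm]
  simp only [Finset.sum_ite_eq', Finset.mem_univ, if_true]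
  rw [two_smul, sub_eq_add_neg]
  congr 1
  rw [← Finset.sum_neg_distrib]
  refine Finset.sum_congr rfl fun i _ ↦ ?_
  rw [hγ l i m, neg_smul, neg_neg]

theorem commute_pair (haa : ∀ i j, a i * a j = -(a j * a i)) (i j l : ι) :
    a l * (a i * a j) = a i * a j * a l := by
  rw [← mul_assoc, haa l i, neg_mul, mul_assoc, haa l j, mul_neg, neg_neg, mul_assoc]

/-- A product of two contractions commutes with a third, so `a i * a j * a l` is invariant under
cyclic permutation. Hence the sum equals both of its cyclic rewritings, and the three add up to the
Jacobi expression: 3A = 0. -/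
theorem sum_jacobi_eq_zero [CharZero k] [Fintype ι]
    (hJ : ∀ i j l m, ∑ r, (γ i j r * γ r l m + γ j l r * γ r i m + γ l i r * γ r j m) = 0)
    (haa : ∀ i j, a i * a j = -(a j * a i)) (m : ι) :
    ∑ r, (∑ i, ∑ j, γ i j r • (a i * a j)) * ∑ l, γ r l m • a l = 0 := by
  have key : ∑ r, (∑ i, ∑ j, γ i j r • (a i * a j)) * ∑ l, γ r l m • a l =
      ∑ i, ∑ j, ∑ l, (∑ r, γ i j r * γ r l m) • (a i * a j * a l) := by
    simp only [Finset.sum_mul, Finset.sum_smul]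
    rw [Finset.sum_comm]
    refine Finset.sum_congr rfl fun i _ ↦ ?_
    rw [Finset.sum_comm]
    refine Finset.sum_congr rfl fun j _ ↦ ?_
    rw [Finset.sum_comm]
    simp only [Finset.mul_sum, smul_mul_smul_comm]
  have cyc1 : ∑ i, ∑ j, ∑ l, (∑ r, γ i j r * γ r l m) • (a i * a j * a l) =
      ∑ i, ∑ j, ∑ l, (∑ r, γ j l r * γ r i m) • (a i * a j * a l) := by
    rw [Finset.sum_comm_cycle]
    refine Finset.sum_congr rfl fun i _ ↦ Finset.sum_congr rfl fun j _ ↦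
      Finset.sum_congr rfl fun l _ ↦ ?_
    rw [← commute_pair haa, ← mul_assoc]
  have cyc2 : ∑ i, ∑ j, ∑ l, (∑ r, γ j l r * γ r i m) • (a i * a j * a l) =
      ∑ i, ∑ j, ∑ l, (∑ r, γ l i r * γ r j m) • (a i * a j * a l) := by
    rw [Finset.sum_comm_cycle]
    refine Finset.sum_congr rfl fun i _ ↦ Finset.sum_congr rfl fun j _ ↦
      Finset.sum_congr rfl fun l _ ↦ ?_
    rw [← commute_pair haa, ← mul_assoc]
  rw [key]
  set A := ∑ i, ∑ j, ∑ l, (∑ r, γ i j r * γ r l m) • (a i * a j * a l) with hA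
  have h3 : (3 : k) • A = 0 := by
    have : A + A + A = 0 := by
      rw [congrArg₂ (· + ·) (congrArg₂ (· + ·) hA cyc1) (cyc1.trans cyc2)]
      simp only [← Finset.sum_add_distrib, ← add_smul, hJ, zero_smul, Finset.sum_const_zero]
    rw [← this, show (3 : k) = 1 + 1 + 1 by norm_num]
    simp only [add_smul, one_smul]
  exact (smul_eq_zero.mp h3).resolve_left (by norm_num)

/-- With D = Q - T/2, the terms Q² and (QT + TQ)/2 both equal half of ∑ X_l L_l, by the bracket
relation and by the anticommutator of `a` and `b` respectively. In T² the `L` commute while the `b`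
anticommute, so only a Jacobi sum is left. -/
theorem ceDifferential_mul_self [CharZero k] [Fintype ι] [DecidableEq ι]
    (hγ : ∀ i j l, γ j i l = -γ i j l)
    (hJ : ∀ i j l m, ∑ r, (γ i j r * γ r l m + γ j l r * γ r i m + γ l i r * γ r j m) = 0)
    (hXX : ∀ i j, X i * X j - X j * X i = ∑ l, γ i j l • X l)
    (hXa : ∀ i j, X i * a j = a j * X i) (hXb : ∀ i j, X i * b j = b j * X i)
    (haa : ∀ i j, a i * a j = -(a j * a i)) (hbb : ∀ i j, b i * b j = -(b j * b i))
    (hab : ∀ i j, a i * b j + b j * a i = if i = j then 1 else 0) :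
    ceDifferential γ X a b * ceDifferential γ X a b = 0 := by
  set L : ι → E := fun l ↦ ∑ i, ∑ j, γ i j l • (a i * a j) with hL
  set Q : E := ∑ i, X i * a i with hQ
  set T : E := ∑ l, L l * b l with hT
  have hD : ceDifferential γ X a b = Q - (2⁻¹ : k) • T := rfl
  have haL (i l) : a i * L l = L l * a i := by
    simp only [hL, Finset.mul_sum, Finset.sum_mul, mul_smul_comm, smul_mul_assoc, commute_pair haa]
  have hLL (l m) : L l * L m = L m * L l := by
    have : L m = ∑ i, ∑ j, γ i j m • (a i * a j) := rfl
    simp only [this, Finset.mul_sum, Finset.sum_mul, mul_smul_comm, smul_mul_assoc]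
    refine Finset.sum_congr rfl fun i _ ↦ Finset.sum_congr rfl fun j _ ↦ ?_
    rw [← mul_assoc, ← haL, mul_assoc, ← haL, mul_assoc]
  have hXL (i l) : X i * L l = L l * X i := by
    simp only [hL, Finset.mul_sum, Finset.sum_mul, mul_smul_comm, smul_mul_assoc]
    refine Finset.sum_congr rfl fun i _ ↦ Finset.sum_congr rfl fun j _ ↦ ?_
    rw [← mul_assoc, hXa, mul_assoc, hXa, mul_assoc]
  have hbL (l m) : b l * L m = L m * b l + (2 : k) • ∑ j, γ l j m • a j :=
    mul_bracketPart hγ hab l m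
  have hXXa (i j) : X i * a i * (X j * a j) = X i * X j * (a i * a j) := by
    rw [mul_assoc, ← mul_assoc (a i), ← hXa]; simp only [mul_assoc]
  have hQQ : Q * Q = (2⁻¹ : k) • ∑ l, X l * L l := by
    have h1 : Q * Q = ∑ i, ∑ j, X i * X j * (a i * a j) := by
      simp only [hQ, Finset.sum_mul_sum, hXXa]
    have h2 : Q * Q = ∑ i, ∑ j, -(X j * X i * (a i * a j)) := by
      rw [h1, Finset.sum_comm]
      refine Finset.sum_congr rfl fun i _ ↦ Finset.sum_congr rfl fun j _ ↦ ?_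
      rw [haa j i, mul_neg]
    have h3 : Q * Q + Q * Q = ∑ l, X l * L l := by
      nth_rw 1 [h1]
      rw [h2]
      simp only [← Finset.sum_add_distrib, ← sub_eq_add_neg, ← sub_mul, hXX, hL, Finset.sum_mul,
        Finset.mul_sum, smul_mul_assoc, mul_smul_comm]
      rw [Finset.sum_comm_cycle]
    rw [← h3, ← two_smul k, smul_smul, inv_mul_cancel₀ two_ne_zero, one_smul]
  have hQT : Q * T + T * Q = ∑ l, X l * L l := by
    have h1 : Q * T = ∑ l, ∑ i, X i * (L l * (a i * b l)) := by
      rw [hQ, hT, Finset.sum_mul_sum, Finset.sum_comm]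
      refine Finset.sum_congr rfl fun i _ ↦ Finset.sum_congr rfl fun j _ ↦ ?_
      rw [mul_assoc, ← mul_assoc (a j), haL, mul_assoc]
    have h2 : T * Q = ∑ l, ∑ i, X i * (L l * (b l * a i)) := by
      rw [hQ, hT, Finset.sum_mul_sum]
      refine Finset.sum_congr rfl fun i _ ↦ Finset.sum_congr rfl fun j _ ↦ ?_
      rw [mul_assoc, ← mul_assoc (b i), ← hXb, mul_assoc, ← mul_assoc (L i), ← hXL, mul_assoc]
    rw [h1, h2]
    simp only [← Finset.sum_add_distrib, ← mul_add, hab]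
    simp
  have hTT : T * T = 0 := by
    have h1 : T * T = ∑ l, ∑ m, L l * L m * (b l * b m) +
        (2 : k) • ∑ m, (∑ l, L l * ∑ j, γ l j m • a j) * b m := by
      rw [hT, Finset.sum_mul_sum]
      have : ∀ l m, L l * b l * (L m * b m) = L l * L m * (b l * b m) +
          (2 : k) • ((L l * ∑ j, γ l j m • a j) * b m) := by
        intro l m
        rw [mul_assoc, ← mul_assoc (b l), hbL, add_mul, mul_add, smul_mul_assoc, mul_smul_comm]
        simp only [mul_assoc]
      simp only [this, Finset.sum_add_distrib, ← Finset.smul_sum, Finset.sum_mul]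
      congr 2
      rw [Finset.sum_comm]
    have h2 : ∑ l, ∑ m, L l * L m * (b l * b m) = 0 := by
      have : ∑ l, ∑ m, L l * L m * (b l * b m) = -∑ l, ∑ m, L l * L m * (b l * b m) := by
        conv_lhs => rw [Finset.sum_comm]
        simp only [← Finset.sum_neg_distrib]
        refine Finset.sum_congr rfl fun i _ ↦ Finset.sum_congr rfl fun j _ ↦ ?_
        rw [hLL j i, hbb j i, mul_neg]
      have h2' : (2 : k) • ∑ l, ∑ m, L l * L m * (b l * b m) = 0 := by
        rw [two_smul]; nth_rw 1 [this]; exact neg_add_cancel _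
      exact (smul_eq_zero.mp h2').resolve_left two_ne_zero
    rw [h1, h2]
    simp only [hL, sum_jacobi_eq_zero hJ haa, zero_mul, Finset.sum_const_zero, smul_zero, add_zero]
  rw [hD, sub_mul, mul_sub, mul_sub, smul_mul_smul_comm, hTT, smul_zero, sub_zero, hQQ, ← hQT,
    mul_smul_comm, smul_mul_assoc, smul_add]
  abel

end CanonicalAnticommutation

/-! ### Contraction and wedge operators on V ⊗ Λ, in coordinates indexed by finite sets. -/

section Fock

variable {ι : Type*} [LinearOrder ι]

/-- The sign `(-1) ^ #{j ∈ S | j < i}` of moving `i` to its place in `S`. -/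
def insertSign (i : ι) (S : Finset ι) : ℤ := (-1) ^ (S.filter (· < i)).card

theorem insertSign_mul_self (i : ι) (S : Finset ι) : insertSign i S * insertSign i S = 1 := by
  rw [insertSign, ← mul_pow]; simp

theorem insertSign_insert {i j : ι} {S : Finset ι} (hj : j ∉ S) :
    insertSign i (insert j S) = if j < i then -insertSign i S else insertSign i S := by
  unfold insertSign
  rw [Finset.filter_insert]
  split_ifs with h
  · rw [Finset.card_insert_of_notMem (by simp [hj]), pow_succ]; ring
  · rfl

theorem insertSign_erase {i j : ι} {S : Finset ι} (hj : j ∈ S) :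
    insertSign i (S.erase j) = if j < i then -insertSign i S else insertSign i S := by
  have := insertSign_insert (i := i) (Finset.notMem_erase j S)
  rw [Finset.insert_erase hj] at this
  split_ifs at this ⊢ <;> simp [this]

variable (R V : Type*) [Ring R] [AddCommGroup V] [Module R V]

/-- Contraction with the `i`-th coordinate on `V ⊗ Λ(ι)`, realised as `Finset ι → V`. -/
def contract (i : ι) : (Finset ι → V) →ₗ[R] (Finset ι → V) where
  toFun f S := if i ∈ S then 0 else insertSign i S • f (insert i S)
  map_add' f g := by ext S; simp only [Pi.add_apply]; split_ifs <;> simp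
  map_smul' c f := by
    ext S; simp only [Pi.smul_apply, RingHom.id_apply]; split_ifs <;> simp [smul_comm c]

/-- Wedge product with the `i`-th basis vector on `V ⊗ Λ(ι)`, realised as `Finset ι → V`. -/
def wedge (i : ι) : (Finset ι → V) →ₗ[R] (Finset ι → V) where
  toFun f S := if i ∈ S then insertSign i S • f (S.erase i) else 0
  map_add' f g := by ext S; simp only [Pi.add_apply]; split_ifs <;> simp
  map_smul' c f := by
    ext S; simp only [Pi.smul_apply, RingHom.id_apply]; split_ifs <;> simp [smul_comm c]

variable {R V}

theorem contract_apply (i : ι) (f : Finset ι → V) (S : Finset ι) :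
    contract R V i f S = if i ∈ S then 0 else insertSign i S • f (insert i S) := rfl

theorem wedge_apply (i : ι) (f : Finset ι → V) (S : Finset ι) :
    wedge R V i f S = if i ∈ S then insertSign i S • f (S.erase i) else 0 := rfl

theorem contract_anticomm (i j : ι) :
    contract R V i * contract R V j = -(contract R V j * contract R V i) := by
  ext f S
  simp only [Module.End.mul_apply, LinearMap.neg_apply, Pi.neg_apply, contract_apply,
    Finset.mem_insert]
  rcases eq_or_ne i j with rfl | hij
  · simp
  by_cases hi : i ∈ S <;> by_cases hj : j ∈ S <;> simp only [hi, hj, hij, hij.symm, if_true,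
    or_true, or_false, if_false, smul_zero, neg_zero]
  rw [insertSign_insert hi, insertSign_insert hj, Finset.insert_comm j i]
  rcases hij.lt_or_gt with h | h
  · simp only [h, h.not_gt, if_true, if_false, smul_smul]
    rw [← neg_smul]; congr 1; ring
  · simp only [h, h.not_gt, if_true, if_false, smul_smul]
    rw [← neg_smul]; congr 1; ring

theorem wedge_anticomm (i j : ι) :
    wedge R V i * wedge R V j = -(wedge R V j * wedge R V i) := by
  ext f S
  simp only [Module.End.mul_apply, LinearMap.neg_apply, Pi.neg_apply, wedge_apply,
    Finset.mem_erase]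
  rcases eq_or_ne i j with rfl | hij
  · simp
  by_cases hi : i ∈ S <;> by_cases hj : j ∈ S <;> simp only [hi, hj, hij, hij.symm, if_true,
    ne_eq, not_false_eq_true, and_true, and_false, if_false, smul_zero, neg_zero]
  rw [insertSign_erase hi, insertSign_erase hj, Finset.erase_right_comm]
  rcases hij.lt_or_gt with h | h
  · simp only [h, h.not_gt, if_true, if_false, smul_smul]
    rw [← neg_smul]; congr 1; ring
  · simp only [h, h.not_gt, if_true, if_false, smul_smul]
    rw [← neg_smul]; congr 1; ring

/-- For distinct indices exactly one of the two insertion signs changes when the other index is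
inserted or erased, so the two products cancel. -/
theorem contract_mul_wedge_add (i j : ι) :
    contract R V i * wedge R V j + wedge R V j * contract R V i = if i = j then 1 else 0 := by
  ext f S
  rcases eq_or_ne i j with rfl | hij
  · simp only [LinearMap.add_apply, Module.End.mul_apply, Pi.add_apply, wedge_apply, contract_apply,
      if_true, Module.End.one_apply]
    by_cases hi : i ∈ S
    · simp [hi, insertSign_erase hi, smul_smul, insertSign_mul_self]
    · simp [hi, insertSign_insert hi, smul_smul, insertSign_mul_self]
  · simp only [LinearMap.add_apply, Module.End.mul_apply, Pi.add_apply, wedge_apply, contract_apply,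
      if_neg hij, LinearMap.zero_apply, Pi.zero_apply, Finset.mem_insert, Finset.mem_erase]
    by_cases hi : i ∈ S <;> by_cases hj : j ∈ S <;> simp only [hi, hj, hij, hij.symm, if_true,
      ne_eq, not_false_eq_true, and_true, and_false, if_false, smul_zero, or_true, or_false, add_zero]
    rw [insertSign_insert hi, insertSign_erase hj, Finset.erase_insert_of_ne hij]
    rcases hij.lt_or_gt with h | h
    · simp only [h, h.not_gt, if_true, if_false, smul_smul]
      rw [← add_smul]; ring_nf; simp
    · simp only [h, h.not_gt, if_true, if_false, smul_smul]
      rw [← add_smul]; ring_nf; simp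

theorem wedge_contract_apply (i : ι) (f : Finset ι → V) (S : Finset ι) :
    wedge R V i (contract R V i f) S = if i ∈ S then f S else 0 := by
  simp only [wedge_apply, contract_apply]
  split_ifs with hi h
  · simp at h
  · rw [insertSign_erase hi, if_neg (lt_irrefl i), smul_smul, insertSign_mul_self, one_smul,
      Finset.insert_erase hi]
  · rfl

variable (ι) in
/-- Apply an endomorphism of `V` coefficientwise on `V ⊗ Λ(ι)`. -/
def coeffwise : Module.End R V →+* Module.End R (Finset ι → V) where
  toFun X := X.compLeft (Finset ι)
  map_one' := rfl
  map_mul' _ _ := rfl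
  map_zero' := rfl
  map_add' _ _ := rfl

omit [LinearOrder ι] in
theorem coeffwise_apply (X : Module.End R V) (f : Finset ι → V) (S : Finset ι) :
    coeffwise ι X f S = X (f S) := rfl

omit [LinearOrder ι] in
theorem coeffwise_smul {k : Type*} [Field k] [Module k V] (c : k) (X : Module.End k V) :
    coeffwise ι (c • X) = c • coeffwise ι X := rfl

theorem coeffwise_contract (X : Module.End R V) (i : ι) :
    coeffwise ι X * contract R V i = contract R V i * coeffwise ι X := by
  ext f S
  simp only [Module.End.mul_apply, coeffwise_apply, contract_apply]
  split_ifs <;> simp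

theorem coeffwise_wedge (X : Module.End R V) (i : ι) :
    coeffwise ι X * wedge R V i = wedge R V i * coeffwise ι X := by
  ext f S
  simp only [Module.End.mul_apply, coeffwise_apply, wedge_apply]
  split_ifs <;> simp

variable (R V) in
/-- The degree `p` part of `V ⊗ Λ(ι)`. -/
def degreePart (ι : Type*) (p : ℕ) : Submodule R (Finset ι → V) where
  carrier := {f | ∀ S, S.card ≠ p → f S = 0}
  add_mem' hf hg S hS := by simp [hf S hS, hg S hS]
  zero_mem' _ _ := rfl
  smul_mem' c f hf S hS := by simp [hf S hS]

omit [LinearOrder ι] in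
theorem mem_degreePart {p : ℕ} {f : Finset ι → V} :
    f ∈ degreePart R V ι p ↔ ∀ S, S.card ≠ p → f S = 0 := Iff.rfl

theorem contract_mem_degreePart {p : ℕ} {f : Finset ι → V} (hf : f ∈ degreePart R V ι (p + 1))
    (i : ι) : contract R V i f ∈ degreePart R V ι p := by
  intro S hS
  rw [contract_apply]
  split_ifs with h
  · rfl
  · rw [hf _ (by rw [Finset.card_insert_of_notMem h]; simpa using hS), smul_zero]

theorem wedge_mem_degreePart {p : ℕ} {f : Finset ι → V} (hf : f ∈ degreePart R V ι p)
    (i : ι) : wedge R V i f ∈ degreePart R V ι (p + 1) := by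
  intro S hS
  rw [wedge_apply]
  split_ifs with h
  · rw [hf _ (fun h' ↦ hS (by rw [← h', Finset.card_erase_add_one h])), smul_zero]
  · rfl

omit [LinearOrder ι] in
theorem coeffwise_mem_degreePart {p : ℕ} {f : Finset ι → V} (hf : f ∈ degreePart R V ι p)
    (X : Module.End R V) : coeffwise ι X f ∈ degreePart R V ι p := fun S hS ↦ by
  rw [coeffwise_apply, hf S hS, map_zero]

/-- This is the number operator: each index in `S` contributes `f S` once. -/
theorem sum_wedge_contract_of_mem [Fintype ι] {p : ℕ} {f : Finset ι → V}
    (hf : f ∈ degreePart R V ι p) : ∑ i, wedge R V i (contract R V i f) = p • f := by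
  ext S
  simp only [Finset.sum_apply, wedge_contract_apply, Finset.sum_ite_mem, Finset.univ_inter,
    Finset.sum_const, Pi.smul_apply]
  by_cases hS : S.card = p
  · rw [hS]
  · rw [hf S hS]; simp

end Fock

/-! ### Exactness of the Chevalley–Eilenberg complex from Weyl relations on the associated graded
space. -/

section KoszulFiltration

variable {k V ι : Type*} [Field k] [AddCommGroup V] [Module k V] [Fintype ι] [LinearOrder ι]

/-- A representation `X` of a Lie algebra (with basis `ι` and structure constants `γ`) on a filtered
vector space, together with operators `δ` that on the associated graded space satisfy the Weyl
relations `[δ i, X j] = δ_{ij}` with the `X j`, which commute there. The filtration starts with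
`G 0 = 0`. -/
structure IsWeylFiltration (γ : ι → ι → ι → k) (X δ : ι → Module.End k V)
    (G : ℕ → Submodule k V) : Prop where
  antisymm : ∀ i j l, γ j i l = -γ i j l
  jacobi : ∀ i j l m, ∑ r, (γ i j r * γ r l m + γ j l r * γ r i m + γ l i r * γ r j m) = 0
  bracket : ∀ i j, X i * X j - X j * X i = ∑ l, γ i j l • X l
  zero : G 0 = ⊥
  mono : Monotone G
  exhaustive : ∀ v, ∃ m, v ∈ G m
  X_mem : ∀ {m v} (i : ι), v ∈ G m → X i v ∈ G (m + 1)
  δ_mem : ∀ {m v} (i : ι), v ∈ G (m + 1) → δ i v ∈ G m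
  comm_mem : ∀ {m v} (i j : ι), v ∈ G (m + 1) →
    δ i (X j v) - X j (δ i v) - (if i = j then v else 0) ∈ G m

namespace IsWeylFiltration

variable {γ : ι → ι → ι → k} {X δ : ι → Module.End k V} {G : ℕ → Submodule k V}

/-- The Euler operator `∑ X i δ i`. -/
def euler (X δ : ι → Module.End k V) : Module.End k V := ∑ i, X i * δ i

omit [LinearOrder ι] in
theorem euler_apply (v : V) : euler X δ v = ∑ i, X i (δ i v) := by
  simp [euler, LinearMap.sum_apply]

theorem euler_mem (hG : IsWeylFiltration γ X δ G) {m : ℕ} {v : V} (hv : v ∈ G m) :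
    euler X δ v ∈ G m := by
  rcases m with - | m
  · rw [hG.zero, Submodule.mem_bot] at hv
    simp [hv]
  · rw [euler_apply]
    exact sum_mem fun i _ ↦ hG.X_mem i (hG.δ_mem i hv)

/-- The Weyl relation gives [E, X_j] = X_j on the graded space. The errors are Weyl defects and
terms [X_i, X_j] δ_i v; a bracket raises the filtration by one only, not by two. -/
theorem euler_X_sub_mem (hG : IsWeylFiltration γ X δ G) {m : ℕ} {v : V} (hv : v ∈ G m) (j : ι) :
    euler X δ (X j v) - X j (euler X δ v) - X j v ∈ G m := by
  rcases m with - | m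
  · rw [hG.zero, Submodule.mem_bot] at hv
    simp [hv]
  have h1 : euler X δ (X j v) - X j (euler X δ v) - X j v =
      ∑ i, (X i (δ i (X j v) - X j (δ i v) - (if i = j then v else 0)) +
        (X i * X j - X j * X i) (δ i v)) := by
    have hite : ∑ i, X i (if i = j then v else 0) = X j v := by
      rw [Finset.sum_eq_single j (fun i _ hi ↦ by simp [hi]) (by simp)]; simp
    simp only [euler_apply, map_sum, map_sub, LinearMap.sub_apply, Module.End.mul_apply,
      Finset.sum_add_distrib, Finset.sum_sub_distrib, hite]
    abel
  rw [h1]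
  refine sum_mem fun i _ ↦ add_mem (hG.X_mem i (hG.comm_mem i j hv)) ?_
  rw [hG.bracket, LinearMap.sum_apply]
  exact sum_mem fun l _ ↦ Submodule.smul_mem _ _ (hG.X_mem l (hG.δ_mem i hv))

/-- The filtration by powers of the ideal generated by the `X j`, modulo lower order terms. -/
def adic (X : ι → Module.End k V) (G : ℕ → Submodule k V) : ℕ → ℕ → Submodule k V
  | 0, m => G m
  | _ + 1, 0 => ⊥
  | n + 1, m + 1 => (⨆ j, (adic X G n m).map (X j)) ⊔ G m

theorem adic_le (hG : IsWeylFiltration γ X δ G) (n m : ℕ) : adic X G n m ≤ G m := by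
  induction n generalizing m with
  | zero => exact le_rfl
  | succ n ih =>
    rcases m with - | m
    · exact bot_le
    · refine sup_le (iSup_le fun j ↦ ?_) (hG.mono m.le_succ)
      rintro _ ⟨v, hv, rfl⟩
      exact hG.X_mem j (ih m hv)

/-- Since `G 0` is zero, an element of filtration m is at most m - 1 steps above the bottom, so a
product of m operators `X j` reaching filtration m can only have lower order. -/
theorem adic_diag_le (hG : IsWeylFiltration γ X δ G) (m : ℕ) : adic X G m m ≤ G (m - 1) := by
  induction m with
  | zero => exact le_rfl
  | succ m ih =>
    refine sup_le (iSup_le fun j ↦ ?_) le_rfl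
    rintro _ ⟨v, hv, rfl⟩
    rcases m with - | m
    · have : v = 0 := by simpa [adic, hG.zero] using hv
      simp [this]
    · exact hG.X_mem j (ih hv)

/-- On the graded space E maps everything into the ideal of the X_j, and each factor X_j shifts E by
one. So E acts as n on the n-th power of that ideal modulo the next power. -/
theorem euler_sub_mem_adic (hG : IsWeylFiltration γ X δ G) (n : ℕ) {m : ℕ} {v : V}
    (hv : v ∈ adic X G n m) : euler X δ v - (n : k) • v ∈ adic X G (n + 1) m := by
  induction n generalizing m v with
  | zero =>
    rw [Nat.cast_zero, zero_smul, sub_zero]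
    rcases m with - | m
    · have : v = 0 := by simpa [adic, hG.zero] using hv
      simp [this]
    · rw [euler_apply]
      refine Submodule.mem_sup_left (sum_mem fun i _ ↦ Submodule.mem_iSup_of_mem i ?_)
      exact Submodule.mem_map_of_mem (hG.δ_mem i hv)
  | succ n ih =>
    rcases m with - | m
    · have : v = 0 := by simpa [adic] using hv
      simp [this]
    have key : adic X G (n + 1) (m + 1) ≤
        (adic X G (n + 2) (m + 1)).comap (euler X δ - ((n + 1 : ℕ) : k) • 1) := by
      refine sup_le (iSup_le fun j ↦ ?_) fun v hv ↦ ?_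
      · rintro _ ⟨u, hu, rfl⟩
        have h2 : (euler X δ - ((n + 1 : ℕ) : k) • (1 : Module.End k V)) (X j u) =
            X j (euler X δ u - (n : k) • u) +
              (euler X δ (X j u) - X j (euler X δ u) - X j u) := by
          simp only [LinearMap.sub_apply, LinearMap.add_apply, LinearMap.smul_apply,
            Module.End.one_apply, map_sub, map_smul, Nat.cast_add, Nat.cast_one, add_smul, one_smul]
          abel
        rw [Submodule.mem_comap, h2]
        refine add_mem (Submodule.mem_sup_left (Submodule.mem_iSup_of_mem j ?_))
          (Submodule.mem_sup_right (hG.euler_X_sub_mem (hG.adic_le _ _ hu) j))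
        exact Submodule.mem_map_of_mem (ih hu)
      · exact Submodule.mem_sup_right
          (sub_mem (hG.euler_mem hv) (Submodule.smul_mem _ _ hv))
    exact key hv

/-- The product `(E - (n - 1)) ⋯ (E - 1) E`. -/
def fallingProd {A : Type*} [Ring A] [Algebra k A] (E : A) : ℕ → A
  | 0 => 1
  | n + 1 => (E - algebraMap k A n) * fallingProd E n

theorem fallingProd_mem_adic (hG : IsWeylFiltration γ X δ G) (n : ℕ) {m : ℕ} {v : V}
    (hv : v ∈ G m) : fallingProd (k := k) (euler X δ) n v ∈ adic X G n m := by
  induction n with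
  | zero => exact hv
  | succ n ih => exact hG.euler_sub_mem_adic n ih

/-- The filtration of `V ⊗ Λ(ι)` induced by one of `V`. -/
def coeffFiltration (ι : Type*) (G : ℕ → Submodule k V) (m : ℕ) : Submodule k (Finset ι → V) :=
  Submodule.pi Set.univ fun _ ↦ G m

omit [Fintype ι] [LinearOrder ι] in
theorem mem_coeffFiltration {m : ℕ} {f : Finset ι → V} :
    f ∈ coeffFiltration ι G m ↔ ∀ S, f S ∈ G m := by
  simp [coeffFiltration, Submodule.mem_pi]

omit [Fintype ι] in
theorem contract_mem_coeffFiltration {m : ℕ} {f : Finset ι → V} (hf : f ∈ coeffFiltration ι G m)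
    (i : ι) : contract k V i f ∈ coeffFiltration ι G m := by
  rw [mem_coeffFiltration] at hf ⊢
  intro S
  rw [contract_apply]
  split_ifs
  exacts [zero_mem _, zsmul_mem (hf _) _]

omit [Fintype ι] in
theorem wedge_mem_coeffFiltration {m : ℕ} {f : Finset ι → V} (hf : f ∈ coeffFiltration ι G m)
    (i : ι) : wedge k V i f ∈ coeffFiltration ι G m := by
  rw [mem_coeffFiltration] at hf ⊢
  intro S
  rw [wedge_apply]
  split_ifs
  exacts [zsmul_mem (hf _) _, zero_mem _]

/-- The Chevalley–Eilenberg differential on `V ⊗ Λ(ι)`. -/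
noncomputable def koszulD (γ : ι → ι → ι → k) (X : ι → Module.End k V) :
    Module.End k (Finset ι → V) :=
  ceDifferential γ (fun i ↦ coeffwise ι (X i)) (contract k V) (wedge k V)

/-- The part of the Chevalley–Eilenberg differential coming from the bracket. -/
def bracketPart (V : Type*) [AddCommGroup V] [Module k V] (γ : ι → ι → ι → k) :
    Module.End k (Finset ι → V) :=
  ∑ l, (∑ i, ∑ j, γ i j l • (contract k V i * contract k V j)) * wedge k V l

/-- The Koszul homotopy. -/
def homotopy (δ : ι → Module.End k V) : Module.End k (Finset ι → V) :=
  ∑ i, wedge k V i * coeffwise ι (δ i)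

theorem koszulD_eq :
    koszulD γ X = ∑ i, coeffwise ι (X i) * contract k V i - (2⁻¹ : k) • bracketPart V γ := rfl

theorem koszulD_koszulD [CharZero k] (hG : IsWeylFiltration γ X δ G) (f : Finset ι → V) :
    koszulD γ X (koszulD γ X f) = 0 := by
  have := ceDifferential_mul_self (X := fun i ↦ coeffwise ι (X i)) (a := contract k V)
    (b := wedge k V) hG.antisymm hG.jacobi
    (fun i j ↦ by
      rw [← map_mul, ← map_mul, ← map_sub, hG.bracket, map_sum]
      simp only [coeffwise_smul])
    (fun i j ↦ coeffwise_contract _ _) (fun i j ↦ coeffwise_wedge _ _)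
    contract_anticomm wedge_anticomm contract_mul_wedge_add
  exact congr($this f)

theorem bracketPart_mem_coeffFiltration {m : ℕ} {f : Finset ι → V}
    (hf : f ∈ coeffFiltration ι G m) : bracketPart V γ f ∈ coeffFiltration ι G m := by
  simp only [bracketPart, LinearMap.sum_apply, Module.End.mul_apply, LinearMap.smul_apply]
  refine sum_mem fun l _ ↦ sum_mem fun i _ ↦ sum_mem fun j _ ↦ Submodule.smul_mem _ _ ?_
  exact contract_mem_coeffFiltration (contract_mem_coeffFiltration
    (wedge_mem_coeffFiltration hf l) j) i

theorem bracketPart_mem_degreePart {p : ℕ} {f : Finset ι → V}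
    (hf : f ∈ degreePart k V ι (p + 1)) : bracketPart V γ f ∈ degreePart k V ι p := by
  simp only [bracketPart, LinearMap.sum_apply, Module.End.mul_apply, LinearMap.smul_apply]
  refine sum_mem fun l _ ↦ sum_mem fun i _ ↦ sum_mem fun j _ ↦ Submodule.smul_mem _ _ ?_
  exact contract_mem_degreePart (contract_mem_degreePart (wedge_mem_degreePart hf l) j) i

theorem koszulD_mem_degreePart {p : ℕ} {f : Finset ι → V}
    (hf : f ∈ degreePart k V ι (p + 1)) : koszulD γ X f ∈ degreePart k V ι p := by
  rw [koszulD_eq, LinearMap.sub_apply, LinearMap.smul_apply, LinearMap.sum_apply]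
  exact sub_mem (sum_mem fun i _ ↦ coeffwise_mem_degreePart (contract_mem_degreePart hf i) (X i))
    (Submodule.smul_mem _ _ (bracketPart_mem_degreePart hf))

theorem homotopy_mem_degreePart {p : ℕ} {f : Finset ι → V}
    (hf : f ∈ degreePart k V ι p) : homotopy δ f ∈ degreePart k V ι (p + 1) := by
  rw [homotopy, LinearMap.sum_apply]
  exact sum_mem fun i _ ↦ wedge_mem_degreePart (coeffwise_mem_degreePart hf (δ i)) i

theorem koszulD_mem_coeffFiltration (hG : IsWeylFiltration γ X δ G) {m : ℕ} {f : Finset ι → V}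
    (hf : f ∈ coeffFiltration ι G m) : koszulD γ X f ∈ coeffFiltration ι G (m + 1) := by
  rw [koszulD_eq, LinearMap.sub_apply, LinearMap.smul_apply, LinearMap.sum_apply]
  refine sub_mem (sum_mem fun i _ ↦ ?_) (Submodule.smul_mem _ _ ?_)
  · have := contract_mem_coeffFiltration hf i
    rw [mem_coeffFiltration] at this ⊢
    exact fun S ↦ hG.X_mem i (this S)
  · have := bracketPart_mem_coeffFiltration (γ := γ) hf
    rw [mem_coeffFiltration] at this ⊢
    exact fun S ↦ hG.mono m.le_succ (this S)

theorem homotopy_mem_coeffFiltration (hG : IsWeylFiltration γ X δ G) {m : ℕ} {f : Finset ι → V}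
    (hf : f ∈ coeffFiltration ι G (m + 1)) : homotopy δ f ∈ coeffFiltration ι G m := by
  rw [homotopy, LinearMap.sum_apply]
  refine sum_mem fun i _ ↦ wedge_mem_coeffFiltration ?_ i
  rw [mem_coeffFiltration] at hf ⊢
  exact fun S ↦ hG.δ_mem i (hf S)

/-- Expand X_i a_i b_j δ_j + b_j δ_j X_i a_i using a_i b_j = δ_ij - b_j a_i. The diagonal gives E,
the commutator [δ_j, X_i] multiplies b_j a_i, and splitting off its expected value δ_ij gives the
number operator. -/
theorem koszul_homotopy (f : Finset ι → V) :
    ∑ i, coeffwise ι (X i) (contract k V i (homotopy δ f)) +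
        homotopy δ (∑ i, coeffwise ι (X i) (contract k V i f)) =
      coeffwise ι (euler X δ) f + ∑ i, wedge k V i (contract k V i f) +
        ∑ i, ∑ j, coeffwise ι (δ j * X i - X i * δ j - if j = i then 1 else 0)
          (wedge k V j (contract k V i f)) := by
  have hca (Y : Module.End k V) (i : ι) (f : Finset ι → V) :
      coeffwise ι Y (contract k V i f) = contract k V i (coeffwise ι Y f) :=
    congr($(coeffwise_contract Y i) f)
  have hcb (Y : Module.End k V) (i : ι) (f : Finset ι → V) :
      wedge k V i (coeffwise ι Y f) = coeffwise ι Y (wedge k V i f) :=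
    congr($(coeffwise_wedge Y i) f).symm
  have hab (i j : ι) (f : Finset ι → V) : contract k V i (wedge k V j f) =
      (if i = j then f else 0) - wedge k V j (contract k V i f) := by
    have := congr($(contract_mul_wedge_add (R := k) (V := V) i j) f)
    rw [eq_sub_iff_add_eq]
    refine Eq.trans this ?_
    split_ifs <;> rfl
  have term (i j : ι) : coeffwise ι (X i) (contract k V i (wedge k V j (coeffwise ι (δ j) f))) +
      wedge k V j (coeffwise ι (δ j) (coeffwise ι (X i) (contract k V i f))) =
      (if j = i then coeffwise ι (X i * δ j) f else 0) +
      (if j = i then wedge k V j (contract k V i f) else 0) +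
        coeffwise ι (δ j * X i - X i * δ j - if j = i then 1 else 0)
          (wedge k V j (contract k V i f)) := by
    simp only [hab, hcb, ← hca, map_sub, map_mul, LinearMap.sub_apply, Module.End.mul_apply]
    rcases eq_or_ne j i with rfl | hij
    · simp only [if_true, map_one, Module.End.one_apply]
      abel
    · simp only [hij, hij.symm, if_false, map_zero, LinearMap.zero_apply]
      abel
  simp only [homotopy, LinearMap.sum_apply, map_sum, Module.End.mul_apply]
  simp only [← Finset.sum_add_distrib, term]
  simp only [Finset.sum_add_distrib, Finset.sum_ite_eq', Finset.mem_univ,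
    if_true, euler, map_sum, LinearMap.sum_apply]

/-- Modulo lower filtration, `D h + h D` is the Euler operator plus the degree. -/
theorem koszulD_homotopy_mem (hG : IsWeylFiltration γ X δ G) {m p : ℕ} {f : Finset ι → V}
    (hf : f ∈ coeffFiltration ι G (m + 1)) (hp : f ∈ degreePart k V ι p) :
    coeffwise ι (euler X δ) f + p • f - koszulD γ X (homotopy δ f) - homotopy δ (koszulD γ X f) ∈
      coeffFiltration ι G m := by
  have h1 := koszul_homotopy (X := X) (δ := δ) f
  rw [sum_wedge_contract_of_mem hp] at h1
  have h2 : coeffwise ι (euler X δ) f + p • f - koszulD γ X (homotopy δ f) -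
      homotopy δ (koszulD γ X f) =
      (2⁻¹ : k) • bracketPart V γ (homotopy δ f) + homotopy δ ((2⁻¹ : k) • bracketPart V γ f) -
      ∑ i, ∑ j, coeffwise ι (δ j * X i - X i * δ j - if j = i then 1 else 0)
          (wedge k V j (contract k V i f)) := by
    rw [eq_sub_iff_add_eq, ← sub_eq_zero, ← sub_eq_zero.mpr h1.symm]
    simp only [koszulD_eq, LinearMap.sub_apply, LinearMap.sum_apply, Module.End.mul_apply, map_sub,
      LinearMap.smul_apply]
    abel
  rw [h2]
  refine sub_mem (add_mem (Submodule.smul_mem _ _ (bracketPart_mem_coeffFiltration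
    (hG.homotopy_mem_coeffFiltration hf))) (hG.homotopy_mem_coeffFiltration
      (Submodule.smul_mem _ _ (bracketPart_mem_coeffFiltration hf))))
    (sum_mem fun i _ ↦ sum_mem fun j _ ↦ ?_)
  have h3 := wedge_mem_coeffFiltration (contract_mem_coeffFiltration hf i) j
  rw [mem_coeffFiltration] at h3 ⊢
  intro S
  have h4 := hG.comm_mem j i (h3 S)
  convert h4 using 1
  rw [coeffwise_apply]
  simp only [LinearMap.sub_apply, Module.End.mul_apply]
  congr 1
  split_ifs <;> rfl

/-- This is exactness of the graded complex: D normally raises the filtration by one, so `hDz` says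
that z is a cycle there. `Z` consists of such cycles and `W` of boundaries plus lower terms. The
homotopy makes E act on Z/W as -(p + 1), while a product of factors E - n with n natural acts as
zero. -/
theorem exists_sub_koszulD_mem [CharZero k] (hG : IsWeylFiltration γ X δ G) {m p : ℕ}
    {z : Finset ι → V} (hz : z ∈ coeffFiltration ι G (m + 1))
    (hp : z ∈ degreePart k V ι (p + 1)) (hDz : koszulD γ X z ∈ coeffFiltration ι G (m + 1)) :
    ∃ w ∈ degreePart k V ι (p + 2), z - koszulD γ X w ∈ coeffFiltration ι G m := by
  set D := koszulD γ X
  set E := coeffwise ι (euler X δ)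
  set Z : Submodule k (Finset ι → V) := coeffFiltration ι G (m + 1) ⊓ degreePart k V ι (p + 1) ⊓
    (coeffFiltration ι G (m + 1)).comap D
  set W : Submodule k (Finset ι → V) :=
    (coeffFiltration ι G m ⊓ degreePart k V ι (p + 2)).map D ⊔
      (coeffFiltration ι G m ⊓ degreePart k V ι (p + 1))
  have hmono : coeffFiltration ι G m ≤ coeffFiltration ι G (m + 1) := fun f hf ↦ by
    rw [mem_coeffFiltration] at hf ⊢
    exact fun S ↦ hG.mono m.le_succ (hf S)
  have hWZ : W ≤ Z := by
    refine sup_le ?_ fun f hf ↦ ⟨⟨hmono hf.1, hf.2⟩, hG.koszulD_mem_coeffFiltration hf.1⟩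
    rintro _ ⟨w, hw, rfl⟩
    refine ⟨⟨hG.koszulD_mem_coeffFiltration hw.1, koszulD_mem_degreePart hw.2⟩, ?_⟩
    have h0 : D (D w) = 0 := hG.koszulD_koszulD w
    exact (congrArg (· ∈ coeffFiltration ι G (m + 1)) h0).mpr (zero_mem _)
  have hE {y} (hy : y ∈ Z) : E y + (p + 1) • y ∈ W := by
    have h1 : E y + (p + 1) • y - D (homotopy δ y) - homotopy δ (D y) ∈ coeffFiltration ι G m :=
      hG.koszulD_homotopy_mem hy.1.1 hy.1.2
    have h2 := hG.homotopy_mem_coeffFiltration hy.1.1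
    have h3 := hG.homotopy_mem_coeffFiltration hy.2
    have h4 : E y + (p + 1) • y - D (homotopy δ y) ∈
        coeffFiltration ι G m ⊓ degreePart k V ι (p + 1) :=
      ⟨by have := add_mem h1 h3; rwa [sub_add_cancel] at this, sub_mem (add_mem (coeffwise_mem_degreePart hy.1.2 _)
        (nsmul_mem hy.1.2 _)) (koszulD_mem_degreePart (homotopy_mem_degreePart hy.1.2))⟩
    rw [← sub_add_cancel (E y + (p + 1) • y) (D (homotopy δ y))]
    exact add_mem (Submodule.mem_sup_right h4) (Submodule.mem_sup_left
      (Submodule.mem_map_of_mem ⟨h2, homotopy_mem_degreePart hy.1.2⟩))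
  have hzZ : z ∈ Z := ⟨⟨hz, hp⟩, hDz⟩
  have hmap (n : ℕ) : coeffwise ι (fallingProd (k := k) (euler X δ) (n + 1)) z =
      E (coeffwise ι (fallingProd (k := k) (euler X δ) n) z) -
        (n : k) • coeffwise ι (fallingProd (k := k) (euler X δ) n) z := rfl
  -- On Z/W the factor E - n acts as -(p + 1 + n), so `c` is a product of such numbers, nonzero in
  -- characteristic zero.
  have key (n : ℕ) : coeffwise ι (fallingProd (k := k) (euler X δ) n) z ∈ Z ∧
      ∃ c : k, c ≠ 0 ∧ coeffwise ι (fallingProd (k := k) (euler X δ) n) z - c • z ∈ W := by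
    induction n with
    | zero => exact ⟨hzZ, 1, one_ne_zero, by simp [fallingProd, map_one]⟩
    | succ n ih =>
      obtain ⟨hZ, c, hc, hcW⟩ := ih
      rw [hmap]
      set y := coeffwise ι (fallingProd (k := k) (euler X δ) n) z
      have h1 : E y - (n : k) • y = (E y + (p + 1) • y) - ((p + 1 + n : ℕ) : k) • y := by
        rw [← Nat.cast_smul_eq_nsmul k, Nat.cast_add (p + 1), add_smul]
        abel
      rw [h1]
      refine ⟨sub_mem (hWZ (hE hZ)) (Submodule.smul_mem _ _ hZ), -((p + 1 + n : ℕ) : k) * c,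
        mul_ne_zero (neg_ne_zero.mpr (Nat.cast_ne_zero.mpr (by lia))) hc, ?_⟩
      have h2 : E y + (p + 1) • y - ((p + 1 + n : ℕ) : k) • y -
          (-((p + 1 + n : ℕ) : k) * c) • z = E y + (p + 1) • y -
          ((p + 1 + n : ℕ) : k) • (y - c • z) := by
        rw [smul_sub, smul_smul, neg_mul, neg_smul]
        abel
      rw [h2]
      exact sub_mem (hE hZ) (Submodule.smul_mem _ _ hcW)
  -- On `G (m + 1)` modulo `G m`, the m + 1 factors E, …, E - m suffice to give zero.
  obtain ⟨hZ, c, hc, hcW⟩ := key (m + 1)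
  have hlow : coeffwise ι (fallingProd (k := k) (euler X δ) (m + 1)) z ∈ coeffFiltration ι G m := by
    rw [mem_coeffFiltration] at hz ⊢
    exact fun S ↦ hG.adic_diag_le _ (hG.fallingProd_mem_adic _ (hz S))
  have hzW : z ∈ W := by
    have h1 : c • z ∈ W := by
      have := sub_mem (Submodule.mem_sup_right ⟨hlow, hZ.1.2⟩ : _ ∈ W) hcW
      simpa using! this
    simpa [smul_smul, inv_mul_cancel₀ hc] using Submodule.smul_mem W c⁻¹ h1
  obtain ⟨_, ⟨w, hw, rfl⟩, y, hy, hwy⟩ := Submodule.mem_sup.mp hzW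
  exact ⟨w, hw.2, by rw [← hwy]; simpa using! hy.1⟩

/-- The Chevalley–Eilenberg complex is exact in positive degrees. -/
theorem koszulD_exact [CharZero k] (hG : IsWeylFiltration γ X δ G) {p : ℕ}
    {z : Finset ι → V} (hp : z ∈ degreePart k V ι (p + 1)) (hDz : koszulD γ X z = 0) :
    ∃ w ∈ degreePart k V ι (p + 2), koszulD γ X w = z := by
  have hex : ∃ m, z ∈ coeffFiltration ι G m := by
    choose N hN using fun S ↦ hG.exhaustive (z S)
    refine ⟨Finset.univ.sup N, mem_coeffFiltration.mpr fun S ↦ ?_⟩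
    exact hG.mono (Finset.le_sup (Finset.mem_univ S)) (hN S)
  obtain ⟨m, hm⟩ := hex
  induction m generalizing z with
  | zero =>
    have : z = 0 := by
      ext S
      simpa [hG.zero] using mem_coeffFiltration.mp hm S
    exact ⟨0, zero_mem _, by rw [map_zero, this]⟩
  | succ m ih =>
    obtain ⟨w, hw, hzw⟩ := hG.exists_sub_koszulD_mem hm hp (by rw [hDz]; exact zero_mem _)
    obtain ⟨w', hw', h⟩ := ih (sub_mem hp (koszulD_mem_degreePart hw))
      (by rw [map_sub, hDz, hG.koszulD_koszulD, sub_zero]) hzw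
    exact ⟨w' + w, add_mem hw' hw, by rw [map_add, h, sub_add_cancel]⟩

end IsWeylFiltration

end KoszulFiltration

/-! ### Projective dimension of cokernels in an exact complex. -/

section DimensionShifting

universe v

variable {R : Type v} [Ring R]

open CategoryTheory

/-- Dimension shifting along an exact complex of projective modules, in terms of cokernels. -/
theorem hasProjectiveDimensionLT_one_coker (C : ℕ → Type v) [∀ n, AddCommGroup (C n)]
    [∀ n, Module R (C n)] [∀ n, Module.Projective R (C n)] (d : ∀ n, C (n + 1) →ₗ[R] C n)
    (hd : ∀ n, LinearMap.ker (d n) = LinearMap.range (d (n + 1))) (n j : ℕ)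
    (h : HasProjectiveDimensionLT (ModuleCat.of R (C j ⧸ LinearMap.range (d j))) (n + 1)) :
    HasProjectiveDimensionLT (ModuleCat.of R (C (j + n) ⧸ LinearMap.range (d (j + n)))) 1 := by
  induction n generalizing j with
  | zero => exact h
  | succ n ih =>
    rw [show j + (n + 1) = j + 1 + n by ring]
    apply ih
    -- By exactness `d j` embeds the cokernel of `d (j + 1)` into `C j`, with the cokernel of `d j`
    -- as quotient; the middle term is projective, so the dimension drops by one.
    let f : (C (j + 1) ⧸ LinearMap.range (d (j + 1))) →ₗ[R] C j :=
      Submodule.liftQ _ (d j) (hd j).ge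
    have hf : LinearMap.range f = LinearMap.range (d j) := Submodule.range_liftQ _ _ _
    have hex : Function.Exact f (LinearMap.range (d j)).mkQ := by
      rw [LinearMap.exact_iff, Submodule.ker_mkQ, hf]
    let S := ModuleCat.shortComplexOfCompEqZero f (LinearMap.range (d j)).mkQ
      hex.linearMap_comp_eq_zero
    have hS : S.ShortExact := by
      refine ModuleCat.shortComplex_shortExact S hex ?_ (Submodule.mkQ_surjective _)
      change Function.Injective f
      rw [← LinearMap.ker_eq_bot]
      exact Submodule.ker_liftQ_eq_bot _ _ _ (hd j).le
    have h2 : Projective S.X₂ := (ModuleCat.of R (C j)).projective_of_categoryTheory_projective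
    exact (hS.hasProjectiveDimensionLT_X₃_iff n h2).mp h

theorem exists_comp_eq_id_of_projective_coker {A B : Type*} [AddCommGroup A] [AddCommGroup B]
    [Module R A] [Module R B] (d : A →ₗ[R] B) (hd : Function.Injective d)
    [Module.Projective R (B ⧸ LinearMap.range d)] : ∃ s : B →ₗ[R] A, s ∘ₗ d = LinearMap.id := by
  obtain ⟨σ, hσ⟩ := Module.projective_lifting_property (LinearMap.range d).mkQ LinearMap.id
    (Submodule.mkQ_surjective _)
  have hmem (b : B) : (LinearMap.id - σ ∘ₗ (LinearMap.range d).mkQ : B →ₗ[R] B) b ∈ LinearMap.range d := by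
    refine (Submodule.ker_mkQ (LinearMap.range d)).le (LinearMap.mem_ker.mpr ?_)
    have := LinearMap.congr_fun hσ ((LinearMap.range d).mkQ b)
    simp only [LinearMap.comp_apply, LinearMap.id_apply] at this
    simp only [LinearMap.sub_apply, LinearMap.comp_apply, LinearMap.id_apply, map_sub, this,
      sub_self]
  refine ⟨(LinearEquiv.ofInjective d hd).symm.toLinearMap ∘ₗ LinearMap.codRestrict _ _ hmem, ?_⟩
  ext a
  simp only [LinearMap.comp_apply, LinearEquiv.coe_coe, LinearMap.id_apply]
  rw [LinearEquiv.symm_apply_eq]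
  ext
  simp only [LinearMap.codRestrict_apply, LinearMap.sub_apply, LinearMap.id_apply,
    LinearMap.comp_apply, LinearEquiv.ofInjective_apply]
  have h0 : (LinearMap.range d).mkQ (d a) = 0 :=
    (Submodule.Quotient.mk_eq_zero _).mpr (LinearMap.mem_range_self d a)
  rw [h0, map_zero, sub_zero]

theorem le_leftGlobalDimension {n : ℕ} (M : Type v) [AddCommGroup M] [Module R M]
    (h : ¬ HasProjectiveDimensionLT (ModuleCat.of R M) n) : (n : WithBot ℕ∞) ≤ leftGlobalDimension R :=
  ((projectiveDimension_ge_iff (ModuleCat.of R M) n).mpr h).trans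
    (le_iSup (fun M : ModuleCat.{v} R ↦ projectiveDimension M) (ModuleCat.of R M))

theorem zero_le_leftGlobalDimension [Nontrivial R] : 0 ≤ leftGlobalDimension R := by
  refine le_leftGlobalDimension (n := 0) R fun h ↦ ?_
  rw [hasProjectiveDimensionLT_zero_iff_isZero] at h
  have := ModuleCat.subsingleton_of_isZero h
  exact not_subsingleton R this

end DimensionShifting

/-! ### The lower bound for the global dimension of an augmented algebra. -/

section GlobalDimension

universe v

open IsWeylFiltration

variable {k : Type*} {ι : Type} {R : Type v} [Field k] [Ring R] [Algebra k R] [Fintype ι]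
  [LinearOrder ι]

instance degreePart_projective (p : ℕ) : Module.Projective R (degreePart R R ι p) := by
  let π : (Finset ι → R) →ₗ[R] degreePart R R ι p :=
    { toFun := fun f ↦ ⟨fun S ↦ if S.card = p then f S else 0, fun S hS ↦ if_neg hS⟩
      map_add' := fun f g ↦ by
        ext S
        simp only [Pi.add_apply, Submodule.coe_add]
        split_ifs <;> simp
      map_smul' := fun c f ↦ by
        ext S
        simp only [Pi.smul_apply, RingHom.id_apply, Submodule.coe_smul]
        split_ifs <;> simp }
  refine Module.Projective.of_split (degreePart R R ι p).subtype π ?_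
  ext f S
  change (if S.card = p then f.1 S else 0) = f.1 S
  split_ifs with h
  · rfl
  · exact (f.2 S h).symm

variable (γ : ι → ι → ι → k) (x : ι → R)

theorem koszulD_smul (r : R) (f : Finset ι → R) :
    koszulD γ (fun i ↦ LinearMap.mulRight k (x i)) (r • f) =
      r • koszulD γ (fun i ↦ LinearMap.mulRight k (x i)) f := by
  have ha (i : ι) (f : Finset ι → R) : contract k R i (r • f) = r • contract k R i f :=
    map_smul (contract R R i) r f
  have hb (i : ι) (f : Finset ι → R) : wedge k R i (r • f) = r • wedge k R i f :=
    map_smul (wedge R R i) r f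
  have hX (i : ι) (f : Finset ι → R) : coeffwise ι (LinearMap.mulRight k (x i)) (r • f) =
      r • coeffwise ι (LinearMap.mulRight k (x i)) f := by
    ext S
    exact mul_assoc r (f S) (x i)
  simp only [koszulD_eq, bracketPart, LinearMap.sub_apply, LinearMap.smul_apply,
    LinearMap.sum_apply, Module.End.mul_apply, ha, hb, hX, smul_sub, Finset.smul_sum,
    smul_comm r]

/-- The components of the Chevalley–Eilenberg complex of an algebra, as a complex of modules. -/
noncomputable def koszulComplexD (p : ℕ) : degreePart R R ι (p + 1) →ₗ[R] degreePart R R ι p where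
  toFun f := ⟨koszulD γ (fun i ↦ LinearMap.mulRight k (x i)) f.1,
    koszulD_mem_degreePart (k := k) f.2⟩
  map_add' f g := by ext1; exact map_add _ _ _
  map_smul' r f := by ext1; exact koszulD_smul γ x r f.1

theorem koszulComplexD_apply (p : ℕ) (f : degreePart R R ι (p + 1)) :
    (koszulComplexD γ x p f : Finset ι → R) =
      koszulD γ (fun i ↦ LinearMap.mulRight k (x i)) f.1 := rfl

variable {γ x}

theorem ker_koszulComplexD [CharZero k] {δ : ι → Module.End k R} {G : ℕ → Submodule k R}
    (hG : IsWeylFiltration γ (fun i ↦ LinearMap.mulRight k (x i)) δ G) (p : ℕ) :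
    LinearMap.ker (koszulComplexD γ x p) = LinearMap.range (koszulComplexD γ x (p + 1)) := by
  ext z
  rw [LinearMap.mem_ker, LinearMap.mem_range]
  constructor
  · intro h
    obtain ⟨w, hw, hwz⟩ := hG.koszulD_exact (z := z.1) z.2 congr(($h).1)
    exact ⟨⟨w, hw⟩, Subtype.ext hwz⟩
  · rintro ⟨w, rfl⟩
    exact Subtype.ext (hG.koszulD_koszulD w.1)

/-- The bracket term wedges first, which kills the top form. The opposite order would leave a trace
of the adjoint action here; in the chosen order that trace instead twists the lowest differential by
scalars, which are of lower filtration and do not affect exactness. -/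
theorem koszulD_single_univ :
    koszulD γ (fun i ↦ LinearMap.mulRight k (x i)) (Pi.single Finset.univ 1) =
      ∑ i, x i • contract k R i (Pi.single Finset.univ 1) := by
  have hb (l : ι) : wedge k R l (Pi.single Finset.univ 1) = 0 := by
    ext S
    rw [wedge_apply, Pi.single_eq_of_ne]
    · simp
    · exact fun h ↦ Finset.notMem_erase l S (h ▸ Finset.mem_univ l)
  have hX (i : ι) : coeffwise ι (LinearMap.mulRight k (x i))
      (contract k R i (Pi.single Finset.univ 1)) =
      x i • contract k R i (Pi.single Finset.univ 1) := by
    ext S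
    rw [coeffwise_apply, Pi.smul_apply, contract_apply]
    split_ifs with h
    · simp
    · by_cases hS : insert i S = Finset.univ
      · simp [hS, (Int.cast_commute _ (x i)).eq]
      · simp [Pi.single_eq_of_ne hS]
  simp [koszulD_eq, bracketPart, LinearMap.sum_apply, hb, hX]

theorem card_le_leftGlobalDimension [CharZero k] {δ : ι → Module.End k R} {G : ℕ → Submodule k R}
    (hG : IsWeylFiltration γ (fun i ↦ LinearMap.mulRight k (x i)) δ G)
    (ε : R →ₐ[k] k) (hε : ∀ i, ε (x i) = 0) :
    ((Fintype.card ι : ℕ) : WithBot ℕ∞) ≤ leftGlobalDimension R := by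
  have : Nontrivial R := ε.toRingHom.domain_nontrivial
  rcases hn : Fintype.card ι with - | n
  · exact zero_le_leftGlobalDimension
  refine le_leftGlobalDimension (degreePart R R ι 0 ⧸ LinearMap.range (koszulComplexD γ x 0))
    fun h ↦ ?_
  have h1 := hasProjectiveDimensionLT_one_coker (fun p ↦ degreePart R R ι p) (koszulComplexD γ x)
    (ker_koszulComplexD hG) n 0 h
  rw [zero_add, ← CategoryTheory.projective_iff_hasProjectiveDimensionLT_one,
    ← IsProjective.iff_projective] at h1
  -- The next module vanishes, as no subset of `ι` has more than n + 1 elements.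
  have hinj : Function.Injective (koszulComplexD γ x n) := by
    rw [← LinearMap.ker_eq_bot, ker_koszulComplexD hG n, LinearMap.range_eq_bot]
    ext f S
    have hf : f = 0 := Subtype.ext <| funext fun S ↦ f.2 S fun hS ↦ by
      have := S.card_le_univ
      omega
    rw [hf, map_zero, LinearMap.zero_apply]
  obtain ⟨s, hs⟩ := exists_comp_eq_id_of_projective_coker (koszulComplexD γ x n) hinj
  let vol : degreePart R R ι (n + 1) := ⟨Pi.single Finset.univ 1, fun S hS ↦
    Pi.single_eq_of_ne (fun h ↦ hS (by rw [h, Finset.card_univ, hn])) _⟩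
  let e (i : ι) : degreePart R R ι n :=
    ⟨contract k R i vol.1, contract_mem_degreePart (R := R) vol.2 i⟩
  have hvol : koszulComplexD γ x n vol = ∑ i, x i • e i := by
    ext1
    rw [koszulComplexD_apply, koszulD_single_univ]
    simp [e, vol]
  have h2 : ∑ i, x i • s (e i) = vol := by
    rw [← LinearMap.id_apply (R := R) vol, ← hs, LinearMap.comp_apply, hvol, map_sum]
    simp only [map_smul]
  have h3 : ∑ i, x i * (s (e i)).1 Finset.univ = 1 := by
    have := congr(($h2).1 Finset.univ)
    simpa [vol, Finset.sum_apply] using this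
  -- Every term on the left contains some `x i`, so the augmentation gives 0 = 1.
  have h4 := congr(ε $h3)
  simp [map_sum, hε] at h4

end GlobalDimension

/-! ### The action of the dual algebra on a coalgebra. -/

section DualAction

variable (k : Type*) {C : Type*} [Field k] [AddCommGroup C] [Module k C]

/-- The contraction `id ⊗ f` of a tensor with a functional. -/
noncomputable def contractRight (f : C →ₗ[k] k) : C ⊗[k] C →ₗ[k] C :=
  (TensorProduct.rid k C).toLinearMap ∘ₗ f.lTensor C

/-- The contraction `f ⊗ id` of a tensor with a functional. -/
noncomputable def contractLeft (f : C →ₗ[k] k) : C ⊗[k] C →ₗ[k] C :=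
  (TensorProduct.lid k C).toLinearMap ∘ₗ f.rTensor C

/-- The functional `f ⊗ g`. -/
noncomputable def tensorFunctional (f g : C →ₗ[k] k) : C ⊗[k] C →ₗ[k] k :=
  (TensorProduct.lid k k).toLinearMap ∘ₗ TensorProduct.map f g

variable {k}

@[simp] theorem contractRight_tmul (f : C →ₗ[k] k) (x y : C) :
    contractRight k f (x ⊗ₜ y) = f y • x := by simp [contractRight]

@[simp] theorem contractLeft_tmul (f : C →ₗ[k] k) (x y : C) :
    contractLeft k f (x ⊗ₜ y) = f x • y := by simp [contractLeft]

@[simp] theorem tensorFunctional_tmul (f g : C →ₗ[k] k) (x y : C) :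
    tensorFunctional k f g (x ⊗ₜ y) = f x * g y := by simp [tensorFunctional]

theorem eq_of_tensorFunctional_eq {s t : C ⊗[k] C}
    (h : ∀ f g, tensorFunctional k f g s = tensorFunctional k f g t) : s = t := by
  let b := Module.Basis.ofVectorSpace k C
  refine (b.tensorProduct b).ext_elem fun ij ↦ ?_
  obtain ⟨i, j⟩ := ij
  have key : (Finsupp.lapply (i, j) ∘ₗ (b.tensorProduct b).repr.toLinearMap) =
      tensorFunctional k (b.coord i) (b.coord j) := by
    ext x y
    simp [Module.Basis.tensorProduct_repr_tmul_apply, mul_comm]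
  have := h (b.coord i) (b.coord j)
  rwa [← key] at this

variable [Coalgebra k C]

variable (k) in
/-- The action `h ↦ ∑ f(h₂) h₁` of a functional. -/
noncomputable def dualAct (f : C →ₗ[k] k) : Module.End k C :=
  contractRight k f ∘ₗ Coalgebra.comul

variable (k) in
/-- The action `h ↦ ∑ f(h₁) h₂` of a functional. -/
noncomputable def dualActRight (f : C →ₗ[k] k) : Module.End k C :=
  contractLeft k f ∘ₗ Coalgebra.comul

/-- The convolution product of functionals. -/
noncomputable def convolution (f g : C →ₗ[k] k) : C →ₗ[k] k :=
  tensorFunctional k f g ∘ₗ Coalgebra.comul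

/-- Coassociativity, contracted with f and g on the last two legs. -/
theorem dualAct_dualAct (f g : C →ₗ[k] k) (h : C) :
    dualAct k f (dualAct k g h) = dualAct k (convolution f g) h := by
  let Φ : C ⊗[k] (C ⊗[k] C) →ₗ[k] C :=
    (TensorProduct.rid k C).toLinearMap ∘ₗ (tensorFunctional k f g).lTensor C
  have h1 (t : C ⊗[k] C) : contractRight k (convolution f g) t =
      Φ (Coalgebra.comul.lTensor C t) := by
    induction t with
    | zero => simp
    | add s t hs ht => rw [map_add, hs, ht, map_add, map_add]
    | tmul x y => simp [Φ, convolution]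
  have h2 (t : C ⊗[k] C) : dualAct k f (contractRight k g t) =
      Φ (TensorProduct.assoc k C C C (Coalgebra.comul.rTensor C t)) := by
    induction t with
    | zero => simp
    | add s t hs ht => rw [map_add, map_add, hs, ht, map_add, map_add, map_add]
    | tmul x y =>
      rw [contractRight_tmul, map_smul, LinearMap.rTensor_tmul, dualAct, LinearMap.comp_apply]
      induction Coalgebra.comul (R := k) x with
      | zero => simp
      | add s t hs ht => rw [map_add, smul_add, hs, ht, TensorProduct.add_tmul, map_add, map_add]
      | tmul a b => simp [Φ, smul_smul, mul_comm]
  calc dualAct k f (dualAct k g h) = _ := h2 _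
    _ = _ := by rw [Coalgebra.coassoc_apply]
    _ = _ := (h1 _).symm

theorem dualAct_counit (h : C) : dualAct k Coalgebra.counit h = h := by
  simp [dualAct, contractRight]

theorem apply_dualActRight (f g : C →ₗ[k] k) (h : C) :
    g (dualActRight k f h) = f (dualAct k g h) := by
  simp only [dualAct, dualActRight, LinearMap.comp_apply]
  induction Coalgebra.comul (R := k) h with
  | zero => simp
  | add s t hs ht => rw [map_add, map_add, hs, ht, map_add, map_add]
  | tmul x y => simp [mul_comm]

end DualAction

/-! ### The filtration by iterated coinvariants and its Weyl relations. -/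

section CoinvariantFiltration

variable {k H : Type*} [Field k] [Ring H] [Bialgebra k H]

variable (k H) in
/-- The filtration of `H` with `G 0 = 0` and `G (m + 1) / G m` the coinvariants of `H / G m`. -/
noncomputable def coinvFiltration : ℕ → Submodule k H
  | 0 => ⊥
  | m + 1 => ⨅ f : H →ₗ[k] k, (coinvFiltration m).comap (dualAct k f - f 1 • 1)

theorem mem_coinvFiltration_succ {m : ℕ} {h : H} : h ∈ coinvFiltration k H (m + 1) ↔
    ∀ f : H →ₗ[k] k, dualAct k f h - f 1 • h ∈ coinvFiltration k H m := by
  simp [coinvFiltration, Submodule.mem_iInf]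

theorem convolution_one (f g : H →ₗ[k] k) : convolution f g 1 = f 1 * g 1 := by
  simp [convolution, Algebra.TensorProduct.one_def]

/-- As 1 is group-like, evaluation at 1 is multiplicative for convolution, which rewrites the defect
of f·h in terms of defects of h. -/
theorem dualAct_mem_coinvFiltration {m : ℕ} {h : H} (hh : h ∈ coinvFiltration k H m)
    (f : H →ₗ[k] k) : dualAct k f h ∈ coinvFiltration k H m := by
  rcases m with - | m
  · rw [coinvFiltration, Submodule.mem_bot] at hh
    rw [hh, map_zero]
    exact zero_mem _
  · rw [mem_coinvFiltration_succ] at hh ⊢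
    intro g
    have : dualAct k g (dualAct k f h) - g 1 • dualAct k f h =
        (dualAct k (convolution g f) h - convolution g f 1 • h) -
          g 1 • (dualAct k f h - f 1 • h) := by
      rw [dualAct_dualAct, convolution_one, smul_sub, smul_smul]
      abel
    rw [this]
    exact sub_mem (hh _) (Submodule.smul_mem _ _ (hh _))

theorem coinvFiltration_mono : Monotone (coinvFiltration k H) := by
  refine monotone_nat_of_le_succ fun m h hh ↦ mem_coinvFiltration_succ.mpr fun f ↦ ?_
  exact sub_mem (dualAct_mem_coinvFiltration hh f) (Submodule.smul_mem _ _ hh)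

theorem dualAct_mul_primitive {x : H} (hx : Coalgebra.comul (R := k) x = x ⊗ₜ 1 + 1 ⊗ₜ x)
    (f : H →ₗ[k] k) (h : H) : dualAct k f (h * x) =
      dualAct k f h * x + dualAct k (f ∘ₗ LinearMap.mulRight k x) h := by
  simp only [dualAct, LinearMap.comp_apply, Bialgebra.comul_mul, hx]
  induction Coalgebra.comul (R := k) h with
  | zero => simp
  | add s t hs ht => rw [add_mul, map_add, hs, ht, map_add, map_add, add_mul]; abel
  | tmul a b => simp [mul_add]

theorem dualAct_primitive_mul {x : H} (hx : Coalgebra.comul (R := k) x = x ⊗ₜ 1 + 1 ⊗ₜ x)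
    (f : H →ₗ[k] k) (h : H) : dualAct k f (x * h) =
      x * dualAct k f h + dualAct k (f ∘ₗ LinearMap.mulLeft k x) h := by
  simp only [dualAct, LinearMap.comp_apply, Bialgebra.comul_mul, hx]
  induction Coalgebra.comul (R := k) h with
  | zero => simp
  | add s t hs ht => rw [mul_add, map_add, hs, ht, map_add, map_add, mul_add]; abel
  | tmul a b => simp [add_mul]

/-- By `hTX`, the commutator of δ_i with X_j is the action of φ_i ∘ X_j. Modulo the previous step of
the filtration a functional acts by its value at 1, here φ_i(X_j 1) = δ_ij; likewise φ_i(1) = 0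
makes δ_i lower the filtration. -/
theorem isWeylFiltration_coinvFiltration {ι : Type*} [Fintype ι] [LinearOrder ι]
    {γ : ι → ι → ι → k} {X : ι → Module.End k H} {φ : ι → H →ₗ[k] k}
    (hγ : ∀ i j l, γ j i l = -γ i j l)
    (hJ : ∀ i j l m, ∑ r, (γ i j r * γ r l m + γ j l r * γ r i m + γ l i r * γ r j m) = 0)
    (hX : ∀ i j, X i * X j - X j * X i = ∑ l, γ i j l • X l)
    (hφ : ∀ i, φ i 1 = 0) (hφX : ∀ i j, φ i (X j 1) = if i = j then 1 else 0)
    (hTX : ∀ i f h, dualAct k f (X i h) = X i (dualAct k f h) + dualAct k (f ∘ₗ X i) h)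
    (hex : ∀ h, ∃ m, h ∈ coinvFiltration k H m) :
    IsWeylFiltration γ X (fun i ↦ dualAct k (φ i)) (coinvFiltration k H) where
  antisymm := hγ
  jacobi := hJ
  bracket := hX
  zero := rfl
  mono := coinvFiltration_mono
  exhaustive := hex
  X_mem {m v} i hv := by
    induction m generalizing v with
    | zero =>
      rw [coinvFiltration, Submodule.mem_bot] at hv
      rw [hv, map_zero]
      exact zero_mem _
    | succ m ih =>
      rw [mem_coinvFiltration_succ]
      intro f
      have h1 : dualAct k f (X i v) - f 1 • X i v =
          X i (dualAct k f v - f 1 • v) + dualAct k (f ∘ₗ X i) v := by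
        rw [hTX, map_sub, map_smul]
        abel
      rw [h1]
      exact add_mem (ih (mem_coinvFiltration_succ.mp hv f)) (dualAct_mem_coinvFiltration hv _)
  δ_mem {m v} i hv := by
    simpa [hφ] using mem_coinvFiltration_succ.mp hv (φ i)
  comm_mem {m v} i j hv := by
    have := mem_coinvFiltration_succ.mp hv (φ i ∘ₗ X j)
    rw [LinearMap.comp_apply, hφX, ite_smul, one_smul, zero_smul] at this
    rwa [hTX, add_sub_cancel_left]

end CoinvariantFiltration

/-! ### Burnside's theorem and simple subcoalgebras of matrix coefficients. -/

section MatrixCoefficients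

/-- Burnside's theorem: a simple finite-dimensional module over an algebra over an algebraically
closed field realises all endomorphisms. -/
theorem exists_smul_eq_of_isSimpleModule {k A V : Type*} [Field k] [IsAlgClosed k] [Ring A]
    [Algebra k A] [AddCommGroup V] [Module k V] [Module A V] [IsScalarTower k A V]
    [IsSimpleModule A V] [FiniteDimensional k V] (g : V →ₗ[k] V) : ∃ a : A, ∀ v, a • v = g v := by
  -- By Schur's lemma the commutant consists of scalars, so every k-linear map commutes with it and
  -- Jacobson density applies on a finite spanning set.
  have hS := (IsSimpleModule.algebraMap_end_bijective_of_isAlgClosed (A := A) (V := V) k).2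
  let g' : Module.End (Module.End A V) V :=
    { g with
      map_smul' := fun φ v ↦ by
        obtain ⟨c, rfl⟩ := hS φ
        exact map_smul g c v }
  obtain ⟨s, hs⟩ := Module.Finite.fg_top (R := k) (M := V)
  obtain ⟨a, ha⟩ := jacobson_density (R := A) g' s
  refine ⟨a, fun v ↦ ?_⟩
  have hv : v ∈ Submodule.span k (s : Set V) := hs ▸ Submodule.mem_top
  induction hv using Submodule.span_induction with
  | mem v hv => exact (ha v hv).symm
  | zero => simp
  | add v w _ _ hv hw => rw [smul_add, hv, hw, map_add]
  | smul c v _ hv => rw [smul_comm, hv, map_smul]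

variable {k C : Type*} [Field k] [AddCommGroup C] [Module k C] [Coalgebra k C]

theorem IsSubcoalgebra.dualAct_mem {E : Submodule k C} (hE : IsSubcoalgebra k E) {x : C}
    (hx : x ∈ E) (f : C →ₗ[k] k) : dualAct k f x ∈ E := by
  obtain ⟨t, ht⟩ := hE x hx
  rw [dualAct, LinearMap.comp_apply, ← ht]
  clear ht
  induction t with
  | zero => simp
  | add s t hs ht => rw [map_add, map_add]; exact add_mem hs ht
  | tmul a b => simpa using E.smul_mem _ a.2

theorem IsSubcoalgebra.dualActRight_mem {E : Submodule k C} (hE : IsSubcoalgebra k E) {x : C}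
    (hx : x ∈ E) (f : C →ₗ[k] k) : dualActRight k f x ∈ E := by
  obtain ⟨t, ht⟩ := hE x hx
  rw [dualActRight, LinearMap.comp_apply, ← ht]
  clear ht
  induction t with
  | zero => simp
  | add s t hs ht => rw [map_add, map_add]; exact add_mem hs ht
  | tmul a b => simpa using E.smul_mem _ b.2

/-- The span of a linearly independent system of matrix coefficients is a simple subcoalgebra. -/
theorem isSimpleSubcoalgebra_span_coeff {n : Type*} [Fintype n] [DecidableEq n] [Nonempty n]
    {c : n → n → C} (hc : ∀ i j, Coalgebra.comul (R := k) (c i j) = ∑ l, c i l ⊗ₜ c l j)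
    (hdual : ∀ i j, ∃ f : C →ₗ[k] k, ∀ a b, f (c a b) = if a = i ∧ b = j then 1 else 0) :
    IsSimpleSubcoalgebra k (Submodule.span k (Set.range fun ij : n × n ↦ c ij.1 ij.2)) := by
  set D := Submodule.span k (Set.range fun ij : n × n ↦ c ij.1 ij.2)
  have hcD (i j) : c i j ∈ D := Submodule.subset_span ⟨(i, j), rfl⟩
  refine ⟨?_, ?_, fun E hE hED ↦ ?_⟩
  · change D ≤ (LinearMap.range (TensorProduct.mapIncl D D)).comap (Coalgebra.comul (R := k))
    refine Submodule.span_le.mpr ?_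
    rintro _ ⟨⟨i, j⟩, rfl⟩
    rw [SetLike.mem_coe, Submodule.mem_comap, hc]
    exact sum_mem fun l _ ↦ ⟨⟨c i l, hcD i l⟩ ⊗ₜ ⟨c l j, hcD l j⟩, rfl⟩
  · intro h
    obtain ⟨i⟩ := ‹Nonempty n›
    obtain ⟨f, hf⟩ := hdual i i
    have h0 : c i i = 0 := by simpa [h] using hcD i i
    simpa [h0] using hf i i
  · by_cases hE0 : E = ⊥
    · exact Or.inl hE0
    refine Or.inr (le_antisymm hED ?_)
    obtain ⟨x, hx, hx0⟩ := Submodule.exists_mem_ne_zero_of_ne_bot hE0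
    obtain ⟨a, rfl⟩ := (Submodule.mem_span_range_iff_exists_fun k).mp (hED hx)
    obtain ⟨⟨i, j⟩, hij⟩ : ∃ ij, a ij ≠ 0 := by
      by_contra! h
      simp [h] at hx0
    refine Submodule.span_le.mpr ?_
    rintro _ ⟨⟨p, q⟩, rfl⟩
    obtain ⟨f, hf⟩ := hdual i p
    obtain ⟨g, hg⟩ := hdual q j
    have hT (a b) : dualAct k g (c a b) = if b = j then c a q else 0 := by
      simp [dualAct, hc, hg, ite_and, ite_smul]
    have hS (a b) : dualActRight k f (c a b) = if a = i then c p b else 0 := by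
      simp [dualActRight, hc, hf, ite_and, ite_smul]
    -- As with matrix units, acting from both sides isolates the coefficient `a (i, j)` and moves it
    -- to position (p, q), so E contains every `c p q`.
    have h1 : dualAct k g (dualActRight k f (∑ ij, a ij • c ij.1 ij.2)) = a (i, j) • c p q := by
      simp only [map_sum, map_smul, hS, apply_ite (dualAct k g), hT, map_zero, smul_ite, smul_zero,
        Fintype.sum_prod_type]
      simp
    have h2 := hE.dualAct_mem (hE.dualActRight_mem hx f) g
    rw [h1] at h2
    simpa [smul_smul, inv_mul_cancel₀ hij] using E.smul_mem (a (i, j))⁻¹ h2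

end MatrixCoefficients

/-! ### Connectedness makes the coinvariant filtration exhaustive. -/

section Exhaustion

variable {k H : Type*} [Field k]

variable (k) in
/-- The algebra of endomorphisms `dualAct f` of a coalgebra. -/
noncomputable def dualActAlgebra (C : Type*) [AddCommGroup C] [Module k C] [Coalgebra k C] :
    Subalgebra k (Module.End k C) where
  carrier := Set.range (dualAct k)
  mul_mem' := by
    rintro _ _ ⟨f, rfl⟩ ⟨g, rfl⟩
    exact ⟨convolution f g, LinearMap.ext fun h ↦ (dualAct_dualAct f g h).symm⟩
  add_mem' := by
    rintro _ _ ⟨f, rfl⟩ ⟨g, rfl⟩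
    refine ⟨f + g, ?_⟩
    simp [dualAct, contractRight, LinearMap.lTensor_add, LinearMap.add_comp, LinearMap.comp_add]
  algebraMap_mem' c := by
    refine ⟨c • Coalgebra.counit, LinearMap.ext fun h ↦ ?_⟩
    have := dualAct_counit (k := k) h
    simp only [dualAct, contractRight, LinearMap.lTensor_smul, LinearMap.smul_comp,
      LinearMap.comp_smul, LinearMap.smul_apply] at this ⊢
    rw [this]
    rfl

/-- The element of `dualActAlgebra` given by a functional. -/
noncomputable def toDualActAlgebra {C : Type*} [AddCommGroup C] [Module k C] [Coalgebra k C]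
    (f : C →ₗ[k] k) : dualActAlgebra k C := ⟨dualAct k f, f, rfl⟩

theorem exists_fg_dualAct_mem {C : Type*} [AddCommGroup C] [Module k C] [Coalgebra k C]
    (h : C) : ∃ F : Submodule k C, F.FG ∧ ∀ f : C →ₗ[k] k, dualAct k f h ∈ F := by
  classical
  let r := Coalgebra.Repr.arbitrary k h
  refine ⟨Submodule.span k (r.index.image r.left), ⟨_, rfl⟩, fun f ↦ ?_⟩
  rw [dualAct, LinearMap.comp_apply, ← r.eq, map_sum]
  refine sum_mem fun i hi ↦ ?_
  rw [contractRight_tmul]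
  exact Submodule.smul_mem _ _ (Submodule.subset_span (Finset.mem_image_of_mem _ hi))

/-- A `k`-algebra `A` acts on the coalgebra `C` through the dual algebra of `C`. -/
structure IsDualAction {A C : Type*} [AddCommGroup C] [Module k C] [Coalgebra k C] [Ring A]
    [Module A C] (τ : (C →ₗ[k] k) → A) : Prop where
  smul_eq : ∀ f h, τ f • h = dualAct k f h
  surjective : Function.Surjective τ
  counit : τ Coalgebra.counit = 1
  convolution : ∀ f g, τ (convolution f g) = τ f * τ g

theorem isDualAction_toDualActAlgebra (C : Type*) [AddCommGroup C] [Module k C] [Coalgebra k C] :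
    IsDualAction (toDualActAlgebra (k := k) (C := C)) where
  smul_eq _ _ := rfl
  surjective := by
    rintro ⟨_, f, rfl⟩
    exact ⟨f, rfl⟩
  counit := Subtype.ext (LinearMap.ext dualAct_counit)
  convolution f g := Subtype.ext (LinearMap.ext fun h ↦ (dualAct_dualAct f g h).symm)

section

variable {A C : Type*} [AddCommGroup C] [Module k C] [Coalgebra k C] [Ring A] [Algebra k A]
  [Module A C] [IsScalarTower k A C] {τ : (C →ₗ[k] k) → A}

/-- Comodules are locally finite: the orbit of h lies in the span of the left legs of Δh, so a
nonzero cyclic submodule is finite-dimensional and contains a simple one. -/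
theorem exists_simple_submodule_quotient (hτ : IsDualAction τ) (U : Submodule A C) (hU : U ≠ ⊤) :
    ∃ N : Submodule A (C ⧸ U),
      IsSimpleModule A N ∧ Module.Finite k N := by
  obtain ⟨h, hh⟩ : ∃ h, h ∉ U := by
    by_contra! H
    exact hU (eq_top_iff.mpr fun x _ ↦ H x)
  set q : C ⧸ U := Submodule.Quotient.mk h
  have hq : q ≠ 0 := fun h0 ↦ hh ((Submodule.Quotient.mk_eq_zero U).mp h0)
  let Q := Submodule.span A {q}
  obtain ⟨F, hF, hFm⟩ := exists_fg_dualAct_mem (k := k) h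
  have hfin : Module.Finite k Q := by
    have hle : Q.restrictScalars k ≤ F.map (U.mkQ.restrictScalars k) := by
      intro y hy
      obtain ⟨a, rfl⟩ := Submodule.mem_span_singleton.mp hy
      obtain ⟨f, rfl⟩ := hτ.surjective a
      refine ⟨dualAct k f h, hFm f, ?_⟩
      rw [← hτ.smul_eq]
      rfl
    have : FiniteDimensional k (F.map (U.mkQ.restrictScalars k)) :=
      Module.Finite.iff_fg.mpr (hF.map _)
    exact Submodule.finiteDimensional_of_le hle
  have : IsArtinian A Q := isArtinian_of_tower k (inferInstanceAs (IsArtinian k Q))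
  have hbot : (⊤ : Submodule A Q) ≠ ⊥ := by
    intro h0
    have hmem : (⟨q, Submodule.mem_span_singleton_self q⟩ : Q) ∈ (⊤ : Submodule A Q) :=
      Submodule.mem_top
    rw [h0, Submodule.mem_bot] at hmem
    exact hq congr(($hmem).1)
  obtain ⟨N, hN, -⟩ := (IsAtomic.eq_bot_or_exists_atom_le
    (⊤ : Submodule A Q)).resolve_left hbot
  have hNs : IsSimpleModule A N := isSimpleModule_iff_isAtom.mpr hN
  let e : N ≃ₗ[A] N.map Q.subtype :=
    Submodule.equivMapOfInjective _ Q.injective_subtype N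
  refine ⟨N.map Q.subtype, (LinearEquiv.isSimpleModule_iff (M := N) (N := N.map Q.subtype) e).mp hNs, ?_⟩
  have : Module.Finite k (N.restrictScalars k) := inferInstance
  have : Module.Finite k N := this
  exact Module.Finite.equiv (e.restrictScalars k)

end

section

variable [IsAlgClosed k] {A C : Type*} [AddCommGroup C] [Module k C] [Coalgebra k C] [Ring A]
  [Algebra k A] [Module A C] [IsScalarTower k A C] {τ : (C →ₗ[k] k) → A}

/-- If all simple subcoalgebras lie in `k · u`, then the coalgebra acts trivially on its simple
subquotient comodules. -/
theorem smul_eq_of_coradical_le {u : C} (hu : Coalgebra.counit (R := k) u = 1)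
    (hC : coradical k C ≤ Submodule.span k {u}) (hτ : IsDualAction τ)
    (U : Submodule A C) (N : Submodule A (C ⧸ U)) [IsSimpleModule A N]
    [Module.Finite k N] (f : C →ₗ[k] k) (x : N) : τ f • x = f u • x := by
  classical
  let b := Module.finBasis k N
  have : Nontrivial N := IsSimpleModule.nontrivial A N
  have : Nonempty (Fin (Module.finrank k N)) := b.index_nonempty
  have hψ (i) : ∃ ψ : C →ₗ[k] k, ∀ (h : C) (hN : U.mkQ h ∈ N), ψ h = b.coord i ⟨U.mkQ h, hN⟩ := by
    obtain ⟨ψ, hψ⟩ := LinearMap.exists_extend (p := N.restrictScalars k) (b.coord i)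
    refine ⟨ψ ∘ₗ U.mkQ.restrictScalars k, fun h hN ↦ ?_⟩
    exact LinearMap.congr_fun hψ ⟨U.mkQ h, hN⟩
  choose ψ hψ using hψ
  choose h hh using fun j ↦ U.mkQ_surjective (b j : C ⧸ U)
  -- These are the matrix coefficients of N: by `hc`, pairing with g gives the matrix of `τ g`.
  -- Multiplicativity of `τ` then gives `hcomul`, and Burnside's theorem gives `hdual`.
  let c (i j) : C := dualActRight k (ψ i) (h j)
  have hc (g : C →ₗ[k] k) (i j) : g (c i j) = b.coord i (τ g • b j) := by
    have h1 : U.mkQ (dualAct k g (h j)) = ((τ g • b j : N) : C ⧸ U) := by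
      rw [← hτ.smul_eq, map_smul, hh]
      rfl
    rw [apply_dualActRight, hψ i _ (h1 ▸ (τ g • b j : N).2)]
    congr 1
    exact Subtype.ext h1
  have hcomul (i j) : Coalgebra.comul (R := k) (c i j) = ∑ l, c i l ⊗ₜ c l j := by
    refine eq_of_tensorFunctional_eq fun f g ↦ ?_
    rw [← LinearMap.comp_apply]
    change convolution f g (c i j) = _
    simp only [map_sum, tensorFunctional_tmul, hc, hτ.convolution, mul_smul]
    conv_lhs => rw [← b.sum_repr (τ g • b j), Finset.smul_sum, map_sum]
    refine Finset.sum_congr rfl fun l _ ↦ ?_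
    rw [smul_comm, map_smul, smul_eq_mul, mul_comm]
    rfl
  have hdual (i j) : ∃ f : C →ₗ[k] k, ∀ a a', f (c a a') = if a = i ∧ a' = j then 1 else 0 := by
    obtain ⟨a, ha⟩ := exists_smul_eq_of_isSimpleModule (A := A)
      (b.constr k fun a' ↦ if a' = j then b i else 0)
    obtain ⟨f, rfl⟩ := hτ.surjective a
    refine ⟨f, fun a a' ↦ ?_⟩
    rw [hc, ha, b.constr_basis]
    by_cases h : a' = j <;> simp [h, Finsupp.single_apply, eq_comm]
  have hmem (i j) : c i j ∈ Submodule.span k {u} :=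
    hC (le_sSup (a := Submodule.span k (Set.range fun ij : _ × _ ↦ c ij.1 ij.2))
      (Set.mem_ofPred.mpr (isSimpleSubcoalgebra_span_coeff hcomul hdual))
      (Submodule.subset_span ⟨(i, j), rfl⟩))
  have hε (i j) : Coalgebra.counit (R := k) (c i j) = if j = i then 1 else 0 := by
    rw [hc, hτ.counit, one_smul]
    simp [Finsupp.single_apply]
  -- The simple subcoalgebra lies in k·u, and the counit, which acts as the identity matrix,
  -- determines the scalar.
  have hcu (i j) : c i j = (if j = i then (1 : k) else 0) • u := by
    obtain ⟨s, hs⟩ := Submodule.mem_span_singleton.mp (hmem i j)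
    rw [← hε, ← hs, map_smul, hu, smul_eq_mul, mul_one]
  have hbasis (j) : τ f • b j = f u • b j := by
    refine b.ext_elem fun i ↦ ?_
    have h1 := hc f i j
    rw [hcu, map_smul, b.coord_apply] at h1
    rw [← h1, map_smul]
    simp [Finsupp.single_apply, mul_comm]
  have hlin : (Module.toModuleEnd k (S := A) N (τ f)) =
      f u • LinearMap.id := b.ext hbasis
  exact LinearMap.congr_fun hlin x

theorem exists_coinvariant_of_coradical_le {u : C} (hu : Coalgebra.counit (R := k) u = 1)
    (hC : coradical k C ≤ Submodule.span k {u}) (hτ : IsDualAction τ)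
    {U : Submodule A C} (hU : U ≠ ⊤) :
    ∃ h ∉ U, ∀ f : C →ₗ[k] k, dualAct k f h - f u • h ∈ U := by
  obtain ⟨N, hN, hfin⟩ := exists_simple_submodule_quotient hτ U hU
  have : Nontrivial N := IsSimpleModule.nontrivial A N
  obtain ⟨y, hy⟩ := exists_ne (0 : N)
  obtain ⟨h, hh⟩ := U.mkQ_surjective y.1
  refine ⟨h, fun h0 ↦ hy (Subtype.ext (hh ▸ (Submodule.Quotient.mk_eq_zero U).mpr h0)), fun f ↦ ?_⟩
  have h1 : τ f • U.mkQ h = f u • U.mkQ h := by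
    rw [hh]
    exact congr(($(smul_eq_of_coradical_le hu hC hτ U N f y)).1)
  rw [← hτ.smul_eq]
  exact (Submodule.Quotient.eq U).mp h1

end

section

variable [IsAlgClosed k] {A : Type*} [Ring H] [Bialgebra k H] [Ring A] [Algebra k A] [Module A H]
  [IsScalarTower k A H] {τ : (H →ₗ[k] k) → A}

theorem exists_mem_coinvFiltration_of_isDualAction (hτ : IsDualAction τ)
    (hH : coradical k H ≤ Submodule.span k {1}) (x : H) : ∃ m, x ∈ coinvFiltration k H m := by
  let U : Submodule A H :=
    { carrier := {x | ∃ m, x ∈ coinvFiltration k H m}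
      zero_mem' := ⟨0, zero_mem _⟩
      add_mem' := by
        rintro x y ⟨m, hm⟩ ⟨n, hn⟩
        exact ⟨max m n, add_mem (coinvFiltration_mono (le_max_left _ _) hm)
          (coinvFiltration_mono (le_max_right _ _) hn)⟩
      smul_mem' := by
        rintro a x ⟨m, hm⟩
        obtain ⟨f, rfl⟩ := hτ.surjective a
        exact ⟨m, hτ.smul_eq f x ▸ dualAct_mem_coinvFiltration hm f⟩ }
  by_contra hx
  have hU : U ≠ ⊤ := fun h ↦ hx (h.ge (Submodule.mem_top : x ∈ ⊤))
  obtain ⟨h, hhU, hcoinv⟩ := exists_coinvariant_of_coradical_le Bialgebra.counit_one hH hτ hU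
  obtain ⟨F, hF, hFm⟩ := exists_fg_dualAct_mem (k := k) h
  have hF' : FiniteDimensional k (F ⊔ Submodule.span k {h} : Submodule k H) :=
    Module.Finite.iff_fg.mpr (hF.sup (Submodule.fg_span_singleton h))
  have hFG : ((F ⊔ Submodule.span k {h}) ⊓ U.restrictScalars k).FG :=
    Module.Finite.iff_fg.mp (Submodule.finiteDimensional_of_le inf_le_left)
  obtain ⟨s, hs⟩ := hFG
  have hsU (y : H) (hy : y ∈ s) : ∃ m, y ∈ coinvFiltration k H m :=
    (hs.le (Submodule.subset_span hy)).2
  choose! N hN using hsU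
  -- All the vectors f·h - f(1)h lie in one finite-dimensional subspace, so a single index of the
  -- filtration serves every f.
  have hle : (F ⊔ Submodule.span k {h}) ⊓ U.restrictScalars k ≤ coinvFiltration k H (s.sup N) := by
    rw [← hs, Submodule.span_le]
    exact fun y hy ↦ coinvFiltration_mono (Finset.le_sup hy) (hN y hy)
  refine hhU ⟨s.sup N + 1, mem_coinvFiltration_succ.mpr fun f ↦ hle ⟨?_, hcoinv f⟩⟩
  exact sub_mem (Submodule.mem_sup_left (hFm f)) (Submodule.smul_mem _ _
    (Submodule.mem_sup_right (Submodule.mem_span_singleton_self h)))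

/-- If the coradical is `k · 1`, then the filtration by iterated coinvariants is exhaustive. -/
theorem exists_mem_coinvFiltration (hH : coradical k H ≤ Submodule.span k {1}) (x : H) :
    ∃ m, x ∈ coinvFiltration k H m :=
  exists_mem_coinvFiltration_of_isDualAction (isDualAction_toDualActAlgebra H) hH x

end

end Exhaustion

/-! ### Transport of Weyl filtrations along a linear equivalence, used for the opposite algebra. -/

section Transport

variable {k V V' ι : Type*} [Field k] [AddCommGroup V] [Module k V] [AddCommGroup V'] [Module k V']
  [Fintype ι] [LinearOrder ι]

theorem IsWeylFiltration.conj {γ : ι → ι → ι → k} {X δ : ι → Module.End k V}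
    {G : ℕ → Submodule k V} (hG : IsWeylFiltration γ X δ G) (e : V ≃ₗ[k] V') :
    IsWeylFiltration γ (fun i ↦ e.conj (X i)) (fun i ↦ e.conj (δ i))
      (fun m ↦ (G m).comap e.symm.toLinearMap) where
  antisymm := hG.antisymm
  jacobi := hG.jacobi
  bracket i j := by
    have := congr(e.conj $(hG.bracket i j))
    simp only [map_sub, map_sum, map_smul] at this
    rw [← this]
    ext v
    simp [LinearEquiv.conj_apply]
  zero := by
    rw [hG.zero]
    ext v
    simp
  mono m n h := Submodule.comap_mono (hG.mono h)
  exhaustive v := hG.exhaustive (e.symm v)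
  X_mem i hv := by
    simpa [LinearEquiv.conj_apply] using hG.X_mem i hv
  δ_mem i hv := by
    simpa [LinearEquiv.conj_apply] using hG.δ_mem i hv
  comm_mem {m v} i j hv := by
    have := hG.comm_mem i j hv
    simp only [LinearEquiv.conj_apply, LinearMap.comp_apply, LinearEquiv.coe_coe,
      LinearEquiv.symm_apply_apply, Submodule.mem_comap, map_sub] at this ⊢
    convert this using 2
    split_ifs <;> simp

end Transport

/-! ### Lie structure constants of commutators in an associative algebra. -/

section StructureConstants

variable {k A ι : Type*} [Field k] [Ring A] [Algebra k A] [Fintype ι] {x : ι → A}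
  {c : ι → ι → ι → k}

theorem structureConstants_antisymm (hx : LinearIndependent k x)
    (hc : ∀ i j, x i * x j - x j * x i = ∑ l, c i j l • x l) (i j l : ι) :
    c j i l = -c i j l := by
  have h : ∑ l, (c j i l + c i j l) • x l = 0 := by
    simp only [add_smul, Finset.sum_add_distrib, ← hc]
    abel
  exact eq_neg_of_add_eq_zero_left (Fintype.linearIndependent_iff.mp hx _ h l)

theorem structureConstants_jacobi (hx : LinearIndependent k x)
    (hc : ∀ i j, x i * x j - x j * x i = ∑ l, c i j l • x l) (i j l m : ι) :
    ∑ r, (c i j r * c r l m + c j l r * c r i m + c l i r * c r j m) = 0 := by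
  have key (i j l : ι) : ∑ m, (∑ r, c i j r * c r l m) • x m =
      (x i * x j - x j * x i) * x l - x l * (x i * x j - x j * x i) := by
    simp only [hc i j, Finset.sum_mul, Finset.mul_sum, smul_mul_assoc, mul_smul_comm,
      ← Finset.sum_sub_distrib, ← smul_sub, hc, Finset.smul_sum, smul_smul, Finset.sum_smul]
    exact Finset.sum_comm
  have h : ∑ m, (∑ r, (c i j r * c r l m + c j l r * c r i m + c l i r * c r j m)) • x m = 0 := by
    simp only [Finset.sum_add_distrib, add_smul, key]
    noncomm_ring
  exact Fintype.linearIndependent_iff.mp hx _ h m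

end StructureConstants

/-! ### Primitive elements and the two inequalities. -/

section Primitives

variable {k H : Type*} [Field k] [Ring H] [HopfAlgebra k H]

theorem mem_primitives {x : H} : x ∈ primitives k H ↔
    Coalgebra.comul (R := k) x = x ⊗ₜ[k] (1 : H) + (1 : H) ⊗ₜ[k] x := Iff.rfl

theorem counit_of_mem_primitives {x : H} (hx : x ∈ primitives k H) :
    Coalgebra.counit (R := k) x = 0 := by
  have h := dualAct_counit (k := k) x
  rw [dualAct, LinearMap.comp_apply, mem_primitives.mp hx, map_add, contractRight_tmul,
    contractRight_tmul, Bialgebra.counit_one, one_smul, add_eq_left] at h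
  simpa [Bialgebra.counit_one] using congr(Coalgebra.counit (R := k) $h)

theorem commutator_mem_primitives {x y : H} (hx : x ∈ primitives k H) (hy : y ∈ primitives k H) :
    x * y - y * x ∈ primitives k H := by
  rw [mem_primitives] at *
  rw [map_sub, Bialgebra.comul_mul, Bialgebra.comul_mul, hx, hy]
  simp only [add_mul, mul_add, Algebra.TensorProduct.tmul_mul_tmul, one_mul, mul_one,
    TensorProduct.sub_tmul, TensorProduct.tmul_sub]
  abel

/-- With 1 in the coradical, x ⊗ 1 lies in H ⊗ H₀ and 1 ⊗ x in H₀ ⊗ H. Local finiteness thereby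
bounds the dimension of P(H). -/
theorem primitives_le_coradicalFiltration (hconn : IsConnected k H) :
    primitives k H ≤ coradicalFiltration k H 1 := by
  intro x hx
  have h1 : (1 : H) ∈ coradical k H := hconn.ge (Submodule.mem_span_singleton_self 1)
  rw [coradicalFiltration, Submodule.mem_comap, mem_primitives.mp hx]
  exact add_mem (Submodule.mem_sup_left ⟨(⟨x, trivial⟩ : (⊤ : Submodule k H)) ⊗ₜ
      (⟨1, h1⟩ : coradicalFiltration k H 0), rfl⟩)
    (Submodule.mem_sup_right ⟨(⟨1, h1⟩ : coradical k H) ⊗ₜ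
      (⟨x, trivial⟩ : (⊤ : Submodule k H)), rfl⟩)

theorem exists_dual_functionals {ι : Type*} [DecidableEq ι] {x : ι → H}
    (hx : LinearIndependent k x) (hp : ∀ i, x i ∈ primitives k H) :
    ∃ φ : ι → H →ₗ[k] k, (∀ i, φ i 1 = 0) ∧ ∀ i j, φ i (x j) = if i = j then 1 else 0 := by
  have hψ (i) : ∃ ψ : H →ₗ[k] k, ∀ j, ψ (x j) = if i = j then 1 else 0 := by
    obtain ⟨ψ, hψ⟩ := LinearMap.exists_extend (Finsupp.lapply i ∘ₗ hx.repr)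
    refine ⟨ψ, fun j ↦ ?_⟩
    let y : Submodule.span k (Set.range x) := ⟨x j, Submodule.subset_span ⟨j, rfl⟩⟩
    refine (LinearMap.congr_fun hψ y).trans ?_
    simp [hx.repr_eq_single j y rfl, Finsupp.single_apply, eq_comm]
  choose ψ hψ using hψ
  -- Subtracting a multiple of the counit forces the value 0 at 1 and changes nothing on primitives,
  -- where the counit vanishes.
  refine ⟨fun i ↦ ψ i - ψ i 1 • Coalgebra.counit, fun i ↦ ?_, fun i j ↦ ?_⟩
  · simp [Bialgebra.counit_one]
  · simp [counit_of_mem_primitives (hp j), hψ]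

section

variable [IsAlgClosed k] [CharZero k] {d : ℕ} {x : Fin d → H}
  {c : Fin d → Fin d → Fin d → k}

theorem le_leftGlobalDimension_of_primitives (hconn : IsConnected k H)
    (hx : LinearIndependent k x) (hp : ∀ i, x i ∈ primitives k H)
    (hc : ∀ i j, x i * x j - x j * x i = ∑ l, c i j l • x l) :
    (d : WithBot ℕ∞) ≤ leftGlobalDimension H := by
  obtain ⟨φ, hφ1, hφ⟩ := exists_dual_functionals hx hp
  -- Right multiplication reverses commutators, hence the sign.
  have hG : IsWeylFiltration (fun i j l ↦ -c i j l) (fun i ↦ LinearMap.mulRight k (x i))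
      (fun i ↦ dualAct k (φ i)) (coinvFiltration k H) := by
    refine isWeylFiltration_coinvFiltration
      (fun i j l ↦ congrArg Neg.neg (structureConstants_antisymm hx hc i j l))
      (fun i j l m ↦ by simpa only [neg_mul_neg] using structureConstants_jacobi hx hc i j l m)
      (fun i j ↦ ?_) hφ1 (fun i j ↦ by simpa using hφ i j)
      (fun i f h ↦ dualAct_mul_primitive (hp i) f h)
      (exists_mem_coinvFiltration hconn.le)
    ext h
    have := congr(h * $(hc i j))
    simp only [mul_sub, Finset.mul_sum, mul_smul_comm] at this
    simp only [LinearMap.sub_apply, Module.End.mul_apply, LinearMap.mulRight_apply,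
      LinearMap.sum_apply, LinearMap.smul_apply, neg_smul, Finset.sum_neg_distrib, ← this,
      mul_assoc, neg_sub]
  simpa using card_le_leftGlobalDimension hG (Bialgebra.counitAlgHom k H)
    (fun i ↦ counit_of_mem_primitives (hp i))

theorem le_rightGlobalDimension_of_primitives (hconn : IsConnected k H)
    (hx : LinearIndependent k x) (hp : ∀ i, x i ∈ primitives k H)
    (hc : ∀ i j, x i * x j - x j * x i = ∑ l, c i j l • x l) :
    (d : WithBot ℕ∞) ≤ rightGlobalDimension H := by
  obtain ⟨φ, hφ1, hφ⟩ := exists_dual_functionals hx hp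
  have hG : IsWeylFiltration c (fun i ↦ LinearMap.mulLeft k (x i))
      (fun i ↦ dualAct k (φ i)) (coinvFiltration k H) := by
    refine isWeylFiltration_coinvFiltration (structureConstants_antisymm hx hc)
      (structureConstants_jacobi hx hc) (fun i j ↦ ?_) hφ1 (fun i j ↦ by simpa using hφ i j)
      (fun i f h ↦ dualAct_primitive_mul (hp i) f h)
      (exists_mem_coinvFiltration hconn.le)
    ext h
    have := congr($(hc i j) * h)
    simp only [sub_mul, Finset.sum_mul, smul_mul_assoc] at this
    simp only [LinearMap.sub_apply, Module.End.mul_apply, LinearMap.mulLeft_apply,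
      LinearMap.sum_apply, LinearMap.smul_apply, ← this, mul_assoc]
  -- Left multiplications on H become right multiplications on the opposite algebra.
  have hG' := hG.conj (MulOpposite.opLinearEquiv k)
  have hX (i) : (MulOpposite.opLinearEquiv k).conj (LinearMap.mulLeft k (x i)) =
      LinearMap.mulRight k (MulOpposite.op (x i)) := rfl
  simp only [hX] at hG'
  rw [rightGlobalDimension]
  simpa using card_le_leftGlobalDimension hG'
    ((Bialgebra.counitAlgHom k H).fromOpposite fun _ _ ↦ mul_comm _ _)
    (fun i ↦ counit_of_mem_primitives (hp i))

end

end Primitives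

end ConnectedHopf

theorem corollary3p2 {k : Type*} {H : Type*} [Field k] [IsAlgClosed k] [CharZero k]
    [Ring H] [HopfAlgebra k H]
    (hconn : ConnectedHopf.IsConnected k H) (hfin : ConnectedHopf.IsLocallyFinite k H) :
    ((Cardinal.toENat (Module.rank k (ConnectedHopf.primitives k H)) : ℕ∞) : WithBot ℕ∞)
        ≤ ConnectedHopf.leftGlobalDimension H ∧
      ((Cardinal.toENat (Module.rank k (ConnectedHopf.primitives k H)) : ℕ∞) : WithBot ℕ∞)
        ≤ ConnectedHopf.rightGlobalDimension H := by
  have : Module.Finite k (ConnectedHopf.coradicalFiltration k H 1) := hfin 1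
  have : Module.Finite k (ConnectedHopf.primitives k H) :=
    Submodule.finiteDimensional_of_le (ConnectedHopf.primitives_le_coradicalFiltration hconn)
  let b := Module.finBasis k (ConnectedHopf.primitives k H)
  have hx : LinearIndependent k fun i ↦ (b i : H) :=
    b.linearIndependent.map' _ (Submodule.ker_subtype _)
  have hp (i) : (b i : H) ∈ ConnectedHopf.primitives k H := (b i).2
  have hc (i j) : (b i : H) * b j - b j * b i = ∑ l, b.repr
      ⟨_, ConnectedHopf.commutator_mem_primitives (hp i) (hp j)⟩ l • (b l : H) := by
    have := congr(($(b.sum_repr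
      ⟨_, ConnectedHopf.commutator_mem_primitives (hp i) (hp j)⟩)).1)
    refine this.symm.trans ?_
    simp only [Submodule.coe_sum, Submodule.coe_smul]
  rw [← Module.finrank_eq_rank, Cardinal.toENat_nat]
  exact ⟨ConnectedHopf.le_leftGlobalDimension_of_primitives hconn hx hp hc,
    ConnectedHopf.le_rightGlobalDimension_of_primitives hconn hx hp hc⟩
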